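/- Let $U\subset\mathbb R$ be an open set, let $\mu$ be the Lebesgue measure on $U$, and let $\Pi(x,y)$ be the kernel of a locally trace class operator $\Pi$ of orthogonal projection acting in the complex Hilbert space $L_2(\mathbb R,\mu)$. (Locally trace class means that $\chi_D\Pi\chi_D$ is of trace class for every bounded Borel set $D\subset\mathbb R$.) A configuration on $\mathbb R$ is a collection of particles, considered without regard to order and without accumulation points; $\#_D(X)$ denotes the number of particles of the configuration $X$ in a bounded Borel set $D$. The space $\mathrm{Conf}(\mathbb R)$ of configurations carries the Borel $\sigma$-algebra of the vague topology, which is the one generated by all the functions $\#_D$. Let $\mathbb P_\Pi$ be the determinantal point process induced by $\Pi$, that is, the probability measure on $\mathrm{Conf}(\mathbb R)$ such that for every bounded Borel function $g$ for which $g-1$ is supported in a bounded Borel set $D$ one has $$\mathbb E_{\mathbb P_\Pi}\prod_{x\in X} g(x)=\det\bigl(1+(g-1)\Pi\chi_D\bigr),$$ where $\det$ is the Fredholm determinant. Suppose that $\Pi$ admits an integrable representation: there are smooth functions $A,B:U\to\mathbb C$ with $$\Pi(x,y)=\frac{A(x)B(y)-B(x)A(y)}{x-y}\quad (x\ne y),\qquad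 \Pi(x,x)=A'(x)B(x)-A(x)B'(x)$$ for $x,y\in U$. Suppose furthermore that there exist $R>0$, $C>0$ and $\varepsilon>0$ such that 1. $|A(x)|\le C|x|^{-1/2+\varepsilon}$ and $|B(x)|\le C|x|^{-1/2+\varepsilon}$ for all $x\in U$ with $0<|x|<R$; 2. $|A(x)|\le C|x|^{1/2-\varepsilon}$ and $|B(x)|\le C|x|^{1/2-\varepsilon}$ for all $x\in U$ with $|x|>R$. Then $\mathbb P_\Pi$ is rigid: for every bounded Borel set $D\subset\mathbb R$, the random variable $\#_D$ is measurable with respect to the $\mathbb P_\Pi$-completion (by all $\mathbb P_\Pi$-null sets) of the $\sigma$-algebra generated by the random variables $\#_{D'}$, where $D'$ runs over the bounded Borel subsets of $\mathbb R\setminus D$. -/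

import Mathlib

open MeasureTheory Bornology
open scoped ContDiff

noncomputable section

/-! ### Configurations on the real line and point processes -/

/-- A configuration on `ℝ`: a collection of particles (with multiplicities) without accumulation
points. `mult x` is the number of particles located at `x`, and every bounded set contains only
finitely many particles; equivalently, an integer-valued purely atomic Radon measure on `ℝ`. -/
@[ext]
structure Configuration where
  mult : ℝ → ℕ
  finite_inter_support : ∀ B : Set ℝ, IsBounded B → (B ∩ Function.support mult).Finite

namespace Configuration

/-- The number of particles of the configuration `X` lying in `B` (used for bounded `B`, where
the sum has finitely many nonzero terms). -/
def count (B : Set ℝ) (X : Configuration) : ℕ := ∑ᶠ x ∈ B, X.mult x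

/-- The σ-algebra generated by the random variables `count B`, where `B` runs over the bounded
Borel subsets of `C`. -/
@[reducible]
def sigmaAlgebraOn (C : Set ℝ) : MeasurableSpace Configuration :=
  ⨆ B ∈ {B : Set ℝ | IsBounded B ∧ MeasurableSet B ∧ B ⊆ C},
    MeasurableSpace.comap (count B) ⊤

/-- The σ-algebra on the space of configurations: it is generated by all particle counts in bounded
Borel sets, that is, it is the Borel σ-algebra of the vague topology. -/
instance : MeasurableSpace Configuration := sigmaAlgebraOn Set.univ

/-- The multiplicative functional `∏_{x ∈ X} g x`, particles being taken with their
multiplicities. When `g = 1` off a bounded set, only finitely many factors differ from `1`. -/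
def multFunctional (g : ℝ → ℂ) (X : Configuration) : ℂ := ∏ᶠ x, g x ^ X.mult x

end Configuration

/-- A point process `P` is rigid if, for every bounded Borel set `B`, the number of particles in
`B` is measurable with respect to the `P`-completion of the σ-algebra generated by the particle
counts in bounded Borel subsets of the complement of `B`. The completion consists of the sets that
coincide with a set of that σ-algebra up to a `P`-null set. -/
def IsRigid (P : Measure Configuration) : Prop :=
  ∀ B : Set ℝ, IsBounded B → MeasurableSet B →
    Measurable[eventuallyMeasurableSpace (Configuration.sigmaAlgebraOn Bᶜ) (ae P)]
      (Configuration.count B)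

/-! ### Trace class operators and Fredholm determinants -/

/-- A bounded operator on a Hilbert space is of trace class (nuclear) if it is a sum
`∑ ⟨uₙ, ·⟩ vₙ` of operators of rank at most one with `∑ ‖uₙ‖ ‖vₙ‖ < ∞`. -/
def IsTraceClass {H : Type} [NormedAddCommGroup H] [InnerProductSpace ℂ H]
    (T : H →L[ℂ] H) : Prop :=
  ∃ u v : ℕ → H, Summable (fun n => ‖u n‖ * ‖v n‖) ∧
    ∀ x, HasSum (fun n => inner ℂ (u n) x • v n) (T x)

open Classical in
/-- `HasFredholmDet T d` says that `d` is the Fredholm determinant `det (1 + T)`. In every Hilbert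
basis `e` one has `det (1 + T) = ∑ₙ tr (Λⁿ T)`, and the right side is the sum, over all finite sets
`S` of basis indices, of the principal minors `det (⟨e i, T e j⟩)` with `i, j ∈ S`; the sum
converges absolutely and does not depend on the basis when `T` is of trace class. -/
def HasFredholmDet {H : Type} [NormedAddCommGroup H] [InnerProductSpace ℂ H]
    (T : H →L[ℂ] H) (d : ℂ) : Prop :=
  ∀ (ι : Type) (e : HilbertBasis ι ℂ H),
    HasSum (fun S : Finset ι =>
      (Matrix.of fun i j : {i // i ∈ S} => inner ℂ (e i) (T (e j))).det) d

/-! ### Operators in `L²(ℝ, μ)` and determinantal point processes -/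

/-- A bounded Borel function. -/
structure IsBddMeasurable (g : ℝ → ℂ) : Prop where
  measurable : Measurable g
  bounded : ∃ C : ℝ, ∀ x, ‖g x‖ ≤ C

theorem IsBddMeasurable.memLp {g : ℝ → ℂ} (hg : IsBddMeasurable g) (μ : Measure ℝ) :
    MemLp g ⊤ μ := by
  obtain ⟨C, hC⟩ := hg.bounded
  exact memLp_top_of_bound hg.measurable.aestronglyMeasurable C (Filter.Eventually.of_forall hC)

theorem IsBddMeasurable.sub_one {g : ℝ → ℂ} (hg : IsBddMeasurable g) :
    IsBddMeasurable (fun x => g x - 1) := by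
  obtain ⟨C, hC⟩ := hg.bounded
  refine ⟨hg.measurable.sub_const 1, C + 1, fun x => ?_⟩
  calc ‖g x - 1‖ ≤ ‖g x‖ + ‖(1 : ℂ)‖ := norm_sub_le _ _
    _ ≤ C + 1 := by simpa using hC x

theorem isBddMeasurable_indicator {B : Set ℝ} (hB : MeasurableSet B) :
    IsBddMeasurable (B.indicator fun _ => (1 : ℂ)) := by
  refine ⟨measurable_const.indicator hB, 1, fun x => ?_⟩
  by_cases hx : x ∈ B <;> simp [hx]

/-- The operator of multiplication by the bounded Borel function `g` in `L²(ℝ, μ)`. -/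
def mulOp (μ : Measure ℝ) (g : ℝ → ℂ) (hg : IsBddMeasurable g) :
    Lp ℂ 2 μ →L[ℂ] Lp ℂ 2 μ :=
  (ContinuousLinearMap.mul ℂ ℂ).holderL μ ⊤ 2 2 ((hg.memLp μ).toLp g)

/-- The operator `χ_B` of multiplication by the indicator function of the Borel set `B`. -/
def restrictOp (μ : Measure ℝ) (B : Set ℝ) (hB : MeasurableSet B) :
    Lp ℂ 2 μ →L[ℂ] Lp ℂ 2 μ :=
  mulOp μ (B.indicator fun _ => (1 : ℂ)) (isBddMeasurable_indicator hB)

/-- `T` is the integral operator with kernel `K` in `L²(ℝ, μ)`. -/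
def IsIntegralOperator (μ : Measure ℝ) (K : ℝ → ℝ → ℂ) (T : Lp ℂ 2 μ →L[ℂ] Lp ℂ 2 μ) : Prop :=
  ∀ f : Lp ℂ 2 μ, ∀ᵐ x ∂μ, Integrable (fun y => K x y * f y) μ ∧ T f x = ∫ y, K x y * f y ∂μ

/-- `T` is locally of trace class: `χ_B T χ_B` is of trace class for every bounded Borel set `B`. -/
def IsLocallyTraceClass (μ : Measure ℝ) (T : Lp ℂ 2 μ →L[ℂ] Lp ℂ 2 μ) : Prop :=
  ∀ (B : Set ℝ) (hB : MeasurableSet B), IsBounded B →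
    IsTraceClass (restrictOp μ B hB ∘L T ∘L restrictOp μ B hB)

/-- `P` is the determinantal point process induced by the operator `T`: for every bounded Borel
function `g` such that `g - 1` vanishes outside a bounded Borel set `B`, the expectation of
`∏_{x ∈ X} g x` is the Fredholm determinant `det (1 + (g - 1) T χ_B)`. -/
def IsDeterminantal (μ : Measure ℝ) (T : Lp ℂ 2 μ →L[ℂ] Lp ℂ 2 μ)
    (P : Measure Configuration) : Prop :=
  ∀ (g : ℝ → ℂ) (hg : IsBddMeasurable g) (B : Set ℝ) (hB : MeasurableSet B), IsBounded B →
    (∀ x, x ∉ B → g x = 1) →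
      Integrable (Configuration.multFunctional g) P ∧
      HasFredholmDet (mulOp μ (fun x => g x - 1) hg.sub_one ∘L T ∘L restrictOp μ B hB)
        (∫ X, Configuration.multFunctional g X ∂P)

/-- The kernel `K` admits on `U` the integrable representation with the smooth functions
`A`, `B`, including the values on the diagonal. -/
structure HasIntegrableForm (U : Set ℝ) (K : ℝ → ℝ → ℂ) (A B : ℝ → ℂ) : Prop where
  smooth_left : ContDiffOn ℝ ∞ A U
  smooth_right : ContDiffOn ℝ ∞ B U
  off_diag : ∀ x ∈ U, ∀ y ∈ U, x ≠ y → K x y = (A x * B y - B x * A y) / ((x : ℂ) - (y : ℂ))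
  diag : ∀ x ∈ U, K x x = deriv A x * B x - A x * deriv B x

end

/-! Write `S_h` for the sum of `h` over the particles. Rigidity follows once every bounded set `B`
admits compactly supported test functions `0 ≤ h ≤ 1`, equal to `1` on `B`, for which the variance
of `S_h` is arbitrarily small. Then `S_h - E S_h` tends to `0`, while `S_h` is the number of
particles in `B` plus a statistic of the particles outside `B`; so that number is an almost sure
limit of functions of the exterior configuration (`isRigid_of_forall_variance_le`).

The variance comes from the defining identity `E ∏ (1 + z h) = det (1 + z h T χ_D)`. Comparing both
sides to second order in `z` gives `Var S_h = tr (h² T χ_D) - tr ((h T χ_D)²)`. Because `T` is a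
projection, this is half the squared Hilbert–Schmidt norm of `[h, T]`
(`IsDeterminantal.variance_linStat`), hence at most half of the energy `∬ |h x - h y|² |k x y|²`.

The integrable form of the kernel enters through `φ = iM / (x + iM)`. The difference `φ x - φ y`
contains the factor `y - x`, which cancels the denominator of the kernel, so `[φ, T]` has rank at
most two. Its operator norm is at most `2`, so its energy is at most `8`, uniformly in `M`
(`kernelEnergy_moebiusCutoff_le`). A real cutoff at scale `M` is a Lipschitz function of `Re φ`, so
its energy is bounded uniformly as well.

Bounded energy becomes small energy by averaging. For widely separated scales the cross terms of the
energy form are negligible (`tendsto_cross_energy`), so a sum of `n` cutoffs has energy of order `n`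
and their mean has energy of order `1 / n` (`exists_cutoffAverage_energy_le`). -/

/-! ### Hilbert–Schmidt operators and the commutator identity. -/

section HilbertSchmidt

variable {H : Type} [NormedAddCommGroup H] [InnerProductSpace ℂ H]
  {ι : Type} (e : HilbertBasis ι ℂ H)

/-- `T` is a Hilbert–Schmidt operator, tested on the Hilbert basis `e`. -/
def IsHilbertSchmidt (T : H →L[ℂ] H) : Prop := Summable fun i : ι => ‖T (e i)‖ ^ 2

/-- The Hilbert–Schmidt inner product, computed in the Hilbert basis `e`. -/
noncomputable def hsInner (S T : H →L[ℂ] H) : ℂ := ∑' i, inner ℂ (S (e i)) (T (e i))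

theorem HilbertBasis.hasSum_norm_inner_sq (x : H) :
    HasSum (fun i => ‖inner ℂ (e i) x‖ ^ 2) (‖x‖ ^ 2) := by
  have h := (e.hasSum_inner_mul_inner x x).mapL Complex.reCLM
  have h2 : Complex.reCLM (inner ℂ x x) = ‖x‖ ^ 2 := by
    rw [inner_self_eq_norm_sq_to_K]
    simp [← Complex.ofReal_pow]
  rw [h2] at h
  refine h.congr_fun (fun i => ?_)
  rw [← inner_conj_symm x (e i)]
  simp [← Complex.normSq_eq_norm_sq, Complex.normSq_apply, -inner_conj_symm]

variable {e}

theorem IsHilbertSchmidt.summable_prod {T : H →L[ℂ] H} (hT : IsHilbertSchmidt e T) :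
    Summable fun p : ι × ι => ‖inner ℂ (e p.2) (T (e p.1))‖ ^ 2 := by
  rw [summable_prod_of_nonneg (fun p => by positivity)]
  exact ⟨fun i => (e.hasSum_norm_inner_sq (T (e i))).summable,
    Summable.congr hT fun i => (e.hasSum_norm_inner_sq (T (e i))).tsum_eq.symm⟩

theorem IsHilbertSchmidt.left_mul {T : H →L[ℂ] H} (hT : IsHilbertSchmidt e T) (L : H →L[ℂ] H) :
    IsHilbertSchmidt e (L * T) := by
  refine Summable.of_nonneg_of_le (fun i => by positivity) (fun i => ?_) (hT.mul_left (‖L‖ ^ 2))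
  rw [← mul_pow]
  exact pow_le_pow_left₀ (norm_nonneg _) (L.le_opNorm _) 2

theorem IsHilbertSchmidt.summable_inner_prod {S T : H →L[ℂ] H} (hS : IsHilbertSchmidt e S)
    (hT : IsHilbertSchmidt e T) :
    Summable fun p : ι × ι =>
      inner ℂ (S (e p.1)) (e p.2) * inner ℂ (e p.2) (T (e p.1)) := by
  refine Summable.of_norm_bounded (hS.summable_prod.add hT.summable_prod) fun p => ?_
  rw [norm_mul, norm_inner_symm (S (e p.1))]
  nlinarith [sq_nonneg (‖inner ℂ (e p.2) (S (e p.1))‖ - ‖inner ℂ (e p.2) (T (e p.1))‖),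
    norm_nonneg (inner ℂ (e p.2) (S (e p.1))), norm_nonneg (inner ℂ (e p.2) (T (e p.1)))]

theorem IsHilbertSchmidt.summable_inner {S T : H →L[ℂ] H} (hS : IsHilbertSchmidt e S)
    (hT : IsHilbertSchmidt e T) : Summable fun i => inner ℂ (S (e i)) (T (e i)) :=
  (hS.summable_inner_prod hT).prod.congr fun i => e.tsum_inner_mul_inner (S (e i)) (T (e i))

variable [CompleteSpace H]

/-- The squared moduli of all matrix entries form a summable double family, which transposition only
permutes. -/
theorem IsHilbertSchmidt.adjoint {T : H →L[ℂ] H} (hT : IsHilbertSchmidt e T) :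
    IsHilbertSchmidt e (star T) := by
  have h := (hT.summable_prod.comp_injective Prod.swap_injective)
  rw [summable_prod_of_nonneg (fun p => by simp only [Function.comp]; positivity)] at h
  have h2 := h.2
  refine Summable.congr h2 fun i => ?_
  rw [← (e.hasSum_norm_inner_sq (star T (e i))).tsum_eq]
  refine tsum_congr fun j => ?_
  rw [ContinuousLinearMap.star_eq_adjoint, ContinuousLinearMap.adjoint_inner_right,
    norm_inner_symm]
  rfl

theorem IsHilbertSchmidt.right_mul {T : H →L[ℂ] H} (hT : IsHilbertSchmidt e T) (L : H →L[ℂ] H) :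
    IsHilbertSchmidt e (T * L) := by
  have := (hT.adjoint.left_mul (star L)).adjoint
  simpa using this

theorem IsHilbertSchmidt.hsInner_star {S T : H →L[ℂ] H} (hS : IsHilbertSchmidt e S)
    (hT : IsHilbertSchmidt e T) : hsInner e (star T) (star S) = hsInner e S T := by
  set f : ι → ι → ℂ := fun i j => inner ℂ (S (e i)) (e j) * inner ℂ (e j) (T (e i)) with hf
  have h : Summable (Function.uncurry f) := hS.summable_inner_prod hT
  have h1 : hsInner e S T = ∑' i, ∑' j, f i j :=
    tsum_congr fun i => (e.tsum_inner_mul_inner (S (e i)) (T (e i))).symm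
  have h2 : hsInner e (star T) (star S) = ∑' j, ∑' i, f i j := by
    refine tsum_congr fun j => ?_
    rw [← e.tsum_inner_mul_inner]
    refine tsum_congr fun i => ?_
    rw [ContinuousLinearMap.star_eq_adjoint, ContinuousLinearMap.star_eq_adjoint,
      ContinuousLinearMap.adjoint_inner_right, ContinuousLinearMap.adjoint_inner_left, mul_comm]
  rw [h1, h2, h.tsum_comm]

theorem hsInner_left_mul (S T L : H →L[ℂ] H) : hsInner e S (L * T) = hsInner e (star L * S) T := by
  refine tsum_congr fun i => ?_
  simp [ContinuousLinearMap.star_eq_adjoint, ContinuousLinearMap.adjoint_inner_left]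

/-- Cyclicity of the trace, obtained by passing to adjoints, where right factors become left
factors. -/
theorem IsHilbertSchmidt.hsInner_right_mul {S T : H →L[ℂ] H} (hS : IsHilbertSchmidt e S)
    (hT : IsHilbertSchmidt e T) (L : H →L[ℂ] H) :
    hsInner e (S * L) T = hsInner e S (T * star L) := by
  rw [← (hS.right_mul L).hsInner_star hT, ← hS.hsInner_star (hT.right_mul _), star_mul, star_mul,
    hsInner_left_mul]

/-- The double series `∑ tᵢⱼ tⱼᵢ` of the matrix of a Hilbert–Schmidt operator. -/
theorem IsHilbertSchmidt.hasSum_mul_swap {A : H →L[ℂ] H} (hA : IsHilbertSchmidt e A) :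
    HasSum (fun p : ι × ι => inner ℂ (e p.1) (A (e p.2)) * inner ℂ (e p.2) (A (e p.1)))
      (hsInner e (star A) A) := by
  have h := hA.adjoint.summable_inner_prod hA
  have h1 : ∑' p : ι × ι, inner ℂ (star A (e p.1)) (e p.2) * inner ℂ (e p.2) (A (e p.1))
      = hsInner e (star A) A := by
    rw [h.tsum_prod]
    simp only [hsInner, e.tsum_inner_mul_inner]
  have h2 := h.hasSum
  rw [h1] at h2
  refine h2.congr_fun fun p => ?_
  rw [ContinuousLinearMap.star_eq_adjoint, ContinuousLinearMap.adjoint_inner_left]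

/-- For a projection `P`, the variance functional of the operator `H` equals half the squared
Hilbert–Schmidt norm of the commutator of `H` and `P`. -/
theorem re_trace_sub_eq_half_commutator {P X D : H →L[ℂ] H} (hP : IsStarProjection P)
    (hX : star X = X) (hD : star D = D) (hDX : D * X = X) (hXD : X * D = X)
    (hPD : IsHilbertSchmidt e (P * D)) :
    IsHilbertSchmidt e (X * P - P * X) ∧
    (∑' i, inner ℂ (e i) ((X * X * P * D) (e i))).re
      - (hsInner e (star (X * P * D)) (X * P * D)).re
      = 1 / 2 * ∑' i, ‖(X * P - P * X) (e i)‖ ^ 2 := by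
  have hPs : star P = P := hP.isSelfAdjoint
  have hPP : P * P = P := hP.isIdempotentElem
  have hPX : IsHilbertSchmidt e (P * X) := by
    have := hPD.right_mul X
    rwa [mul_assoc, hDX] at this
  have hXP : IsHilbertSchmidt e (X * P) := by
    have := hPX.adjoint
    rwa [star_mul, hX, hPs] at this
  -- Inserting `P = P * P` writes the operator as a product of two Hilbert–Schmidt factors, so its
  -- trace is a Hilbert–Schmidt pairing and can be cycled.
  have t1 : ∑' i, inner ℂ (e i) ((X * X * P * D) (e i)) = hsInner e (P * X) (P * X) := by
    have h1 : ∑' i, inner ℂ (e i) ((X * X * P * D) (e i)) = hsInner e 1 ((X * X * P) * (P * D)) := by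
      refine tsum_congr fun i => ?_
      rw [show (X * X * P) * (P * D) = X * X * P * D by simp only [mul_assoc]; rw [← mul_assoc P P, hPP]]
      rfl
    rw [h1, hsInner_left_mul, star_mul, star_mul, hX, hPs, mul_one, ← mul_assoc,
      hPX.hsInner_right_mul hPD, hX, mul_assoc, hDX]
  -- This is `tr ((X P D)²)`; cycling the factor `X` absorbs `D` and leaves the cross term of `‖X P
  -- - P X‖²`.
  have t2 : hsInner e (star (X * P * D)) (X * P * D) = hsInner e (X * P) (P * X) := by
    rw [star_mul, star_mul, hX, hD, hPs, mul_assoc X, hsInner_left_mul, hX, ← mul_assoc X D, hXD,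
      ← mul_assoc, hXP.hsInner_right_mul hPD, hX, mul_assoc, hDX]
  have hnorm : ∀ i, ‖(X * P - P * X) (e i)‖ ^ 2
      = (‖(X * P) (e i)‖ ^ 2 + ‖(P * X) (e i)‖ ^ 2)
        - 2 * (inner ℂ ((X * P) (e i)) ((P * X) (e i))).re := by
    intro i
    rw [sub_apply, @norm_sub_sq ℂ]
    simp only [RCLike.re_eq_complex_re]
    ring
  have hin := hXP.summable_inner hPX
  have hre : HasSum (fun i => (inner ℂ ((X * P) (e i)) ((P * X) (e i))).re)
      (hsInner e (X * P) (P * X)).re := hin.hasSum.mapL Complex.reCLM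
  have hself : ∀ T : H →L[ℂ] H, IsHilbertSchmidt e T →
      ∑' i, ‖T (e i)‖ ^ 2 = (hsInner e T T).re := by
    intro T hT
    have := ((hT.summable_inner hT).hasSum.mapL Complex.reCLM)
    rw [hsInner]
    refine Eq.trans (tsum_congr fun i => ?_) this.tsum_eq
    rw [inner_self_eq_norm_sq_to_K]
    simp [← Complex.ofReal_pow]
  have hsum := (hXP.hasSum.add hPX.hasSum).sub (hre.mul_left 2)
  rw [hself _ hXP, hself _ hPX] at hsum
  have hsym : hsInner e (X * P) (X * P) = hsInner e (P * X) (P * X) := by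
    have := hPX.hsInner_star hPX
    rwa [star_mul, hX, hPs] at this
  refine ⟨hsum.summable.congr fun i => (hnorm i).symm, ?_⟩
  rw [tsum_congr hnorm, hsum.tsum_eq, t1, t2, hsym]
  ring

end HilbertSchmidt

/-! ### Second order expansion of Fredholm determinants. -/

section FredholmExpansion

open Filter Topology

variable {H : Type} [NormedAddCommGroup H] [InnerProductSpace ℂ H]
  {ι : Type} (e : HilbertBasis ι ℂ H)

open Classical in
/-- The principal minor, indexed by the finite set `S`, of the matrix of `A` in the basis `e`. -/
noncomputable def principalMinor (A : H →L[ℂ] H) (S : Finset ι) : ℂ :=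
  (Matrix.of fun i j : {i // i ∈ S} => inner ℂ (e i) (A (e j))).det

theorem principalMinor_smul (c : ℂ) (A : H →L[ℂ] H) (S : Finset ι) :
    principalMinor e (c • A) S = c ^ S.card * principalMinor e A S := by
  classical
  unfold principalMinor
  rw [← Fintype.card_coe S, ← Matrix.det_smul]
  congr 1
  ext i j
  simp

/-- Reindexing by `Fin n` makes the explicit determinant formulas available for minors of size 0, 1
and 2. -/
theorem principalMinor_of_injective (A : H →L[ℂ] H) (S : Finset ι) {n : ℕ} (f : Fin n → ι)
    (hf : Function.Injective f) (hS : ∀ i, i ∈ S ↔ ∃ k, f k = i) :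
    principalMinor e A S = (Matrix.of fun k l => inner ℂ (e (f k)) (A (e (f l)))).det := by
  classical
  unfold principalMinor
  let g : Fin n → {i // i ∈ S} := fun k => ⟨f k, (hS _).2 ⟨k, rfl⟩⟩
  have hg : Function.Bijective g := by
    refine ⟨fun a b h => hf (congrArg Subtype.val h), fun i => ?_⟩
    obtain ⟨k, hk⟩ := (hS _).1 i.2
    exact ⟨k, Subtype.ext hk⟩
  rw [← Matrix.det_submatrix_equiv_self (Equiv.ofBijective g hg)]
  rfl

theorem principalMinor_empty (A : H →L[ℂ] H) : principalMinor e A ∅ = 1 := by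
  rw [principalMinor_of_injective e A ∅ (fun k : Fin 0 => k.elim0) (fun k => k.elim0) (by simp)]
  simp

theorem principalMinor_singleton (A : H →L[ℂ] H) (i : ι) :
    principalMinor e A {i} = inner ℂ (e i) (A (e i)) := by
  rw [principalMinor_of_injective e A {i} (fun _ : Fin 1 => i)
    (Function.injective_of_subsingleton _) (by simp [eq_comm])]
  simp

theorem principalMinor_pair [DecidableEq ι] (A : H →L[ℂ] H) {i j : ι} (hij : i ≠ j) :
    principalMinor e A {i, j} = inner ℂ (e i) (A (e i)) * inner ℂ (e j) (A (e j))
      - inner ℂ (e i) (A (e j)) * inner ℂ (e j) (A (e i)) := by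
  rw [principalMinor_of_injective e A {i, j} ![i, j]]
  · simp [Matrix.det_fin_two]
  · intro a b
    fin_cases a <;> fin_cases b <;> simp [hij, hij.symm]
  · intro k
    simp [Fin.exists_fin_two, eq_comm]

theorem sum_powersetCard_two_principalMinor (A : H →L[ℂ] H) (F : Finset ι) :
    ∑ S ∈ F.powersetCard 2, principalMinor e A S
      = ((∑ i ∈ F, inner ℂ (e i) (A (e i))) ^ 2
        - ∑ p ∈ F ×ˢ F, inner ℂ (e p.1) (A (e p.2)) * inner ℂ (e p.2) (A (e p.1))) / 2 := by
  classical
  simp only [Finset.sum_product]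
  induction F using Finset.induction_on with
  | empty => simp [Finset.powersetCard_eq_empty.2 (show (∅ : Finset ι).card < 2 by simp)]
  | insert a F ha ih =>
    rw [Finset.powersetCard_succ_insert ha, Finset.sum_union, ih, Finset.powersetCard_one,
      Finset.sum_image, Finset.sum_map]
    · have h1 : ∀ x ∈ F, principalMinor e A (insert a {x})
          = inner ℂ (e a) (A (e a)) * inner ℂ (e x) (A (e x))
            - inner ℂ (e a) (A (e x)) * inner ℂ (e x) (A (e a)) := fun x hx =>
        principalMinor_pair e A (fun h => ha (h ▸ hx))
      simp only [Function.Embedding.coeFn_mk]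
      rw [Finset.sum_congr rfl h1, Finset.sum_sub_distrib, ← Finset.mul_sum]
      simp only [Finset.sum_insert ha, Finset.sum_add_distrib]
      rw [Finset.sum_congr rfl fun x _ => mul_comm (inner ℂ (e x) (A (e a))) _]
      ring
    · intro S hS T hT h
      simp only [Finset.coe_map, Set.mem_image, Finset.mem_coe] at hS hT
      obtain ⟨x, hx, rfl⟩ := hS
      obtain ⟨y, hy, rfl⟩ := hT
      have hx' : x ≠ a := fun h => ha (h ▸ hx)
      have hxy : x ∈ insert a ({y} : Finset ι) := by
        have : x ∈ insert a ({x} : Finset ι) := by simp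
        rwa [show insert a ({x} : Finset ι) = insert a {y} from h] at this
      rw [Finset.mem_insert, Finset.mem_singleton] at hxy
      replace hxy := hxy.resolve_left hx'
      rw [hxy]
    · rw [Finset.disjoint_left]
      intro S hS hS'
      obtain ⟨T, -, rfl⟩ := Finset.mem_image.1 hS'
      exact ha ((Finset.mem_powersetCard.1 hS).1 (Finset.mem_insert_self a T))

/-- Squares are cofinal among finite subsets of `ι × ι`, so an unconditional double sum may be
evaluated along them. -/
theorem tendsto_finset_product_self_atTop :
    Tendsto (fun F : Finset ι => F ×ˢ F) atTop atTop := by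
  classical
  refine tendsto_atTop.2 fun G => ?_
  filter_upwards [eventually_ge_atTop (G.image Prod.fst ∪ G.image Prod.snd)] with F hF p hp
  exact Finset.mem_product.2 ⟨hF (Finset.mem_union_left _ (Finset.mem_image_of_mem _ hp)),
    hF (Finset.mem_union_right _ (Finset.mem_image_of_mem _ hp))⟩

/-- The second order expansion of the Fredholm determinant `det (1 + z A)` at `z = 0`. -/
theorem HasFredholmDet.expansion {A : H →L[ℂ] H} {Φ : ℝ → ℂ}
    (hΦ : ∀ z : ℝ, 0 ≤ z → z ≤ 1 → HasFredholmDet ((z : ℂ) • A) (Φ z)) {t q : ℂ}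
    (ht : HasSum (fun i => inner ℂ (e i) (A (e i))) t)
    (hq : HasSum (fun p : ι × ι => inner ℂ (e p.1) (A (e p.2)) * inner ℂ (e p.2) (A (e p.1))) q) :
    ∃ c : ℝ, ∀ z : ℝ, 0 ≤ z → z ≤ 1 →
      ‖Φ z - (1 + z * t + z ^ 2 * ((t ^ 2 - q) / 2))‖ ≤ c * z ^ 3 := by
  classical
  have hz : ∀ z : ℝ, 0 ≤ z → z ≤ 1 →
      HasSum (fun S : Finset ι => (z : ℂ) ^ S.card * principalMinor e A S) (Φ z) := by
    intro z h0 h1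
    exact (hΦ z h0 h1 ι e).congr_fun fun S => (principalMinor_smul e _ A S).symm
  -- The case `z = 1` gives absolute summability of all minors, which dominates every other `z` in
  -- `[0, 1]`.
  have hd : Summable (principalMinor e A) := by
    have := (hz 1 zero_le_one le_rfl).summable
    simpa using this
  have part : ∀ k : ℕ, Summable fun S : Finset ι => if S.card = k then principalMinor e A S else 0 :=
    fun k => by
      refine Summable.of_norm_bounded hd.norm fun S => ?_
      split_ifs <;> simp
  have ht' := ht
  have hq' := hq
  rw [HasSum, SummationFilter.unconditional_filter] at ht' hq'
  -- Evaluating the sum over all `S` along the power sets of finite `F` turns the degree `k` part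
  -- into a limit of finite sums of `k × k` minors.
  have lim : ∀ k : ℕ, Tendsto (fun F : Finset ι => ∑ S ∈ F.powersetCard k, principalMinor e A S) atTop
      (𝓝 (∑' S : Finset ι, if S.card = k then principalMinor e A S else 0)) := by
    intro k
    have h := (part k).hasSum
    rw [HasSum, SummationFilter.unconditional_filter] at h
    refine (h.comp tendsto_finset_powerset_atTop_atTop).congr fun F => ?_
    rw [Function.comp, ← Finset.sum_filter, Finset.powersetCard_eq_filter]
  have e0 : (∑' S : Finset ι, if S.card = 0 then principalMinor e A S else 0) = 1 := by
    refine tendsto_nhds_unique (lim 0) ?_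
    simp [principalMinor_empty]
  have e1 : (∑' S : Finset ι, if S.card = 1 then principalMinor e A S else 0) = t := by
    refine tendsto_nhds_unique (lim 1) ?_
    refine Tendsto.congr (fun F => ?_) ht'
    simp [Finset.powersetCard_one, principalMinor_singleton]
  have e2 : (∑' S : Finset ι, if S.card = 2 then principalMinor e A S else 0)
      = (t ^ 2 - q) / 2 := by
    refine tendsto_nhds_unique (lim 2) ?_
    simp only [sum_powersetCard_two_principalMinor]
    exact ((ht'.pow 2).sub (hq'.comp tendsto_finset_product_self_atTop)).div_const 2
  refine ⟨∑' S, ‖principalMinor e A S‖, fun z h0 h1 => ?_⟩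
  have s0 := (part 0).hasSum
  have s1 := (part 1).hasSum.mul_left (z : ℂ)
  have s2 := (part 2).hasSum.mul_left ((z : ℂ) ^ 2)
  rw [e0] at s0
  rw [e1] at s1
  rw [e2] at s2
  have key := (hz z h0 h1).sub ((s0.add s1).add s2)
  rw [← key.tsum_eq, ← tsum_mul_right]
  refine tsum_of_norm_bounded (hd.norm.mul_right (z ^ 3)).hasSum fun S => ?_
  -- Terms of degree below 3 cancel exactly; in the others `z ^ card ≤ z ^ 3` because `z ≤ 1`.
  rcases lt_or_ge S.card 3 with h | h
  · have hval : (z : ℂ) ^ S.card * principalMinor e A S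
        - ((if S.card = 0 then principalMinor e A S else 0)
          + (z : ℂ) * (if S.card = 1 then principalMinor e A S else 0)
          + (z : ℂ) ^ 2 * (if S.card = 2 then principalMinor e A S else 0)) = 0 := by
      interval_cases S.card <;> simp
    rw [hval, norm_zero]
    positivity
  · rw [if_neg (by omega), if_neg (by omega), if_neg (by omega)]
    simp only [mul_zero, add_zero, sub_zero, norm_mul, norm_pow, Complex.norm_real,
      Real.norm_of_nonneg h0]
    rw [mul_comm]
    exact mul_le_mul_of_nonneg_left (pow_le_pow_of_le_one h0 h1 h) (norm_nonneg _)

end FredholmExpansion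

/-! ### Linear statistics of configurations. -/

section LinearStatistics

/-- By Newton's identity the quadratic coefficient is the second elementary symmetric function. The
base 4 in the error leaves room for the induction, and the resulting bound `4 ^ count` has finite
expectation. -/
theorem abs_multiset_prod_sub_le {z : ℝ} (hz0 : 0 ≤ z) (hz1 : z ≤ 1) (m : Multiset ℝ)
    (hm : ∀ v ∈ m, |v| ≤ 1) :
    |(m.map fun v => 1 + z * v).prod
      - (1 + z * m.sum + z ^ 2 * ((m.sum ^ 2 - (m.map fun v => v ^ 2).sum) / 2))|
      ≤ 4 ^ m.card * z ^ 3 := by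
  -- The induction must also carry bounds on the first two symmetric functions, since adding a
  -- particle feeds them into the remainder.
  suffices h : |m.sum| ≤ m.card ∧ |(m.sum ^ 2 - (m.map fun v => v ^ 2).sum) / 2| ≤ 2 ^ m.card ∧
      |(m.map fun v => 1 + z * v).prod
        - (1 + z * m.sum + z ^ 2 * ((m.sum ^ 2 - (m.map fun v => v ^ 2).sum) / 2))|
        ≤ 4 ^ m.card * z ^ 3 from h.2.2
  induction m using Multiset.induction_on with
  | empty => simp; positivity
  | cons v m ih =>
    obtain ⟨h1, h2, h3⟩ := ih fun w hw => hm w (Multiset.mem_cons_of_mem hw)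
    have hv : |v| ≤ 1 := hm v (Multiset.mem_cons_self v m)
    simp only [Multiset.map_cons, Multiset.prod_cons, Multiset.sum_cons, Multiset.card_cons]
    set s := m.sum
    set s2 := (m.map fun v => v ^ 2).sum
    set p := (m.map fun v => 1 + z * v).prod
    have hN : (m.card : ℝ) ≤ 2 ^ m.card := by exact_mod_cast Nat.lt_two_pow_self.le
    have h24 : (2 : ℝ) ^ m.card ≤ 4 ^ m.card := pow_le_pow_left₀ (by norm_num) (by norm_num) _
    have hz3 : 0 ≤ z ^ 3 := by positivity
    refine ⟨?_, ?_, ?_⟩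
    · push_cast
      linarith [abs_add_le v s]
    · have : ((v + s) ^ 2 - (v ^ 2 + s2)) / 2 = (s ^ 2 - s2) / 2 + v * s := by ring
      rw [this, pow_succ 2 m.card]
      have : |v * s| ≤ 1 * m.card := by rw [abs_mul]; gcongr
      linarith [abs_add_le ((s ^ 2 - s2) / 2) (v * s)]
    · have : (1 + z * v) * p - (1 + z * (v + s) + z ^ 2 * (((v + s) ^ 2 - (v ^ 2 + s2)) / 2))
          = (1 + z * v) * (p - (1 + z * s + z ^ 2 * ((s ^ 2 - s2) / 2)))
            + z ^ 3 * (v * ((s ^ 2 - s2) / 2)) := by ring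
      rw [this]
      refine (abs_add_le _ _).trans ?_
      have a1 : |1 + z * v| ≤ 2 := by
        rw [abs_le] at hv ⊢
        constructor <;> nlinarith
      have b1 : |(1 + z * v) * (p - (1 + z * s + z ^ 2 * ((s ^ 2 - s2) / 2)))|
          ≤ 2 * (4 ^ m.card * z ^ 3) := by rw [abs_mul]; gcongr
      have b2 : |z ^ 3 * (v * ((s ^ 2 - s2) / 2))| ≤ z ^ 3 * (1 * 2 ^ m.card) := by
        rw [abs_mul, abs_mul v, abs_of_nonneg hz3]; gcongr
      have b3 : z ^ 3 * (1 * 2 ^ m.card) ≤ z ^ 3 * (1 * 4 ^ m.card) := by gcongr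
      -- The recursion closes because `2 * 4 ^ n + 2 ^ n ≤ 4 * 4 ^ n`.
      rw [pow_succ 4 m.card]
      nlinarith [mul_nonneg hz3 (pow_nonneg (by norm_num : (0 : ℝ) ≤ 4) m.card)]

namespace Configuration

/-- The linear statistic `∑_{x ∈ X} h x`, used for functions `h` of bounded support. -/
noncomputable def linStat (h : ℝ → ℝ) (X : Configuration) : ℝ := ∑ᶠ x, (X.mult x : ℝ) * h x

/-- The finite set of positions of the particles of `X` in the bounded set `D`. -/
noncomputable def positions {D : Set ℝ} (hD : IsBounded D) (X : Configuration) : Finset ℝ :=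
  (X.finite_inter_support D hD).toFinset

variable {D : Set ℝ} (hD : IsBounded D) (X : Configuration)

theorem mem_positions {x : ℝ} : x ∈ X.positions hD ↔ x ∈ D ∧ X.mult x ≠ 0 := by
  simp [positions]

theorem linStat_eq_sum {h : ℝ → ℝ} (hh : ∀ x, x ∉ D → h x = 0) :
    linStat h X = ∑ x ∈ X.positions hD, (X.mult x : ℝ) * h x := by
  refine finsum_eq_sum_of_support_subset _ fun x hx => ?_
  rw [Finset.mem_coe, mem_positions]
  rw [Function.mem_support] at hx
  refine ⟨by_contra fun h' => hx (by simp [hh x h']), fun h' => hx (by simp [h'])⟩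

theorem count_eq_sum {B : Set ℝ} (hB : B ⊆ D) :
    count B X = ∑ x ∈ X.positions hD, B.indicator X.mult x := by
  rw [count, finsum_mem_def]
  refine finsum_eq_sum_of_support_subset _ fun x hx => ?_
  rw [Finset.mem_coe, mem_positions]
  rw [Function.mem_support] at hx
  have hxB : x ∈ B := by_contra fun h' => hx (Set.indicator_of_notMem h' _)
  exact ⟨hB hxB, by rwa [Set.indicator_of_mem hxB] at hx⟩

theorem linStat_indicator_one {B : Set ℝ} (hB : IsBounded B) :
    linStat (B.indicator fun _ => 1) X = count B X := by
  rw [linStat_eq_sum hB X (fun x hx => Set.indicator_of_notMem hx _), count_eq_sum hB X le_rfl]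
  push_cast
  refine Finset.sum_congr rfl fun x hx => ?_
  have := ((mem_positions hB X).1 hx).1
  simp [this]

theorem linStat_add {h₁ h₂ : ℝ → ℝ} (hD : IsBounded D) (hh₁ : ∀ x, x ∉ D → h₁ x = 0)
    (hh₂ : ∀ x, x ∉ D → h₂ x = 0) :
    linStat (fun x => h₁ x + h₂ x) X = linStat h₁ X + linStat h₂ X := by
  rw [linStat_eq_sum hD X hh₁, linStat_eq_sum hD X hh₂,
    linStat_eq_sum hD X (fun x hx => by rw [hh₁ x hx, hh₂ x hx, add_zero]),
    ← Finset.sum_add_distrib]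
  exact Finset.sum_congr rfl fun x _ => mul_add _ _ _

theorem abs_linStat_le (hD : IsBounded D) {h : ℝ → ℝ} (hh : ∀ x, x ∉ D → h x = 0) (h1 : ∀ x, |h x| ≤ 1) :
    |linStat h X| ≤ count D X := by
  rw [linStat_eq_sum hD X hh, count_eq_sum hD X le_rfl]
  push_cast
  refine (Finset.abs_sum_le_sum_abs _ _).trans (Finset.sum_le_sum fun x hx => ?_)
  rw [Set.indicator_of_mem ((mem_positions hD X).1 hx).1, abs_mul, Nat.abs_cast]
  exact mul_le_of_le_one_right (Nat.cast_nonneg _) (h1 x)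

theorem multFunctional_eq_prod {g : ℝ → ℂ} (hg : ∀ x, x ∉ D → g x = 1) :
    multFunctional g X = ∏ x ∈ X.positions hD, g x ^ X.mult x := by
  refine finprod_eq_prod_of_mulSupport_subset _ fun x hx => ?_
  rw [Finset.mem_coe, mem_positions]
  rw [Function.mem_mulSupport] at hx
  refine ⟨by_contra fun h' => hx (by simp [hg x h']), fun h' => hx (by simp [h'])⟩

theorem multFunctional_one_add_indicator (c : ℂ) (hD : IsBounded D) :
    multFunctional (fun x => 1 + D.indicator (fun _ => c) x) X = (1 + c) ^ count D X := by
  rw [multFunctional_eq_prod hD X (fun x hx => by simp [hx]), count_eq_sum hD X le_rfl,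
    ← Finset.prod_pow_eq_pow_sum]
  refine Finset.prod_congr rfl fun x hx => ?_
  have := ((mem_positions hD X).1 hx).1
  simp [this]

/-- The second order expansion of the multiplicative functional of `1 + z h` at `z = 0`. -/
theorem norm_multFunctional_sub_le (hD : IsBounded D) {h : ℝ → ℝ} (hh : ∀ x, x ∉ D → h x = 0) (h1 : ∀ x, |h x| ≤ 1)
    {z : ℝ} (hz0 : 0 ≤ z) (hz1 : z ≤ 1) :
    ‖multFunctional (fun x => 1 + (z : ℂ) * (h x : ℂ)) X
      - ((1 + z * linStat h X
        + z ^ 2 * ((linStat h X ^ 2 - linStat (fun x => h x ^ 2) X) / 2) : ℝ) : ℂ)‖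
      ≤ 4 ^ count D X * z ^ 3 := by
  rw [multFunctional_eq_prod hD X (fun x hx => by simp [hh x hx]), linStat_eq_sum hD X hh,
    linStat_eq_sum hD X (h := fun x => h x ^ 2) (fun x hx => by simp [hh x hx])]
  -- The values of `h` at the particles, repeated according to multiplicity.
  set m : Multiset ℝ := ∑ x ∈ X.positions hD, Multiset.replicate (X.mult x) (h x) with hm
  have hs : m.sum = ∑ x ∈ X.positions hD, (X.mult x : ℝ) * h x := by
    rw [hm, Multiset.sum_sum]
    simp
  have hs2 : (m.map fun v => v ^ 2).sum = ∑ x ∈ X.positions hD, (X.mult x : ℝ) * h x ^ 2 := by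
    rw [hm, ← Multiset.coe_mapAddMonoidHom, map_sum, Multiset.sum_sum]
    simp
  have hp : (m.map fun v => 1 + z * v).prod = ∏ x ∈ X.positions hD, (1 + z * h x) ^ X.mult x := by
    rw [hm, ← Multiset.coe_mapAddMonoidHom, map_sum, Multiset.prod_sum]
    simp
  have hc : m.card = count D X := by
    rw [hm, Multiset.card_sum, count_eq_sum hD X le_rfl]
    refine Finset.sum_congr rfl fun x hx => ?_
    have := ((mem_positions hD X).1 hx).1
    simp [this]
  have key := abs_multiset_prod_sub_le hz0 hz1 m (fun v hv => by
    obtain ⟨x, -, hx⟩ := Multiset.mem_sum.1 hv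
    rw [Multiset.eq_of_mem_replicate hx]
    exact h1 x)
  rw [hs, hs2, hp, hc, ← Real.norm_eq_abs, ← Complex.norm_real, Complex.ofReal_sub] at key
  convert key using 3
  push_cast
  rfl

theorem measurable_count_on {B C : Set ℝ} (hB : IsBounded B) (hBm : MeasurableSet B)
    (hBC : B ⊆ C) : Measurable[sigmaAlgebraOn C] (count B) := by
  rw [measurable_iff_comap_le]
  exact le_iSup₂_of_le (f := fun (B : Set ℝ) (_ : B ∈ {B : Set ℝ | IsBounded B ∧ MeasurableSet B ∧ B ⊆ C}) =>
    MeasurableSpace.comap (count B) ⊤) B ⟨hB, hBm, hBC⟩ le_rfl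

/-- The counting measure of the particles of `X` in the bounded set `D`. -/
noncomputable def particleMeasure (hD : IsBounded D) (X : Configuration) : Measure ℝ :=
  ∑ x ∈ X.positions hD, (X.mult x) • Measure.dirac x

/-- The statistic is the integral of `h` against the particle measure, and the masses of that
measure are counts in bounded subsets of `C`. Nonnegativity of `h` allows the use of the Lebesgue
integral with values in `ENNReal`. -/
theorem measurable_linStat_on {C : Set ℝ} {h : ℝ → ℝ} (hD : IsBounded D) (hDm : MeasurableSet D)
    (hDC : D ⊆ C) (hm : Measurable h) (h0 : ∀ x, 0 ≤ h x) (hh : ∀ x, x ∉ D → h x = 0) :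
    Measurable[sigmaAlgebraOn C] (linStat h) := by
  let _ := sigmaAlgebraOn C
  have hpm : Measurable (particleMeasure hD) := by
    refine Measure.measurable_of_measurable_coe _ fun s hs => ?_
    have : (fun X : Configuration => particleMeasure hD X s)
        = fun X => ((count (s ∩ D) X : ℕ) : ENNReal) := by
      funext X
      rw [particleMeasure, count_eq_sum hD X Set.inter_subset_right, Measure.finsetSum_apply]
      push_cast
      refine Finset.sum_congr rfl fun x hx => ?_
      have := ((mem_positions hD X).1 hx).1
      by_cases hxs : x ∈ s <;> simp [hs, hxs, this]
    rw [this]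
    exact (measurable_of_countable _).comp (measurable_count_on (hD.subset Set.inter_subset_right)
      (hs.inter hDm) (Set.inter_subset_right.trans hDC))
  have hl := (Measure.measurable_lintegral (f := fun x => ENNReal.ofReal (h x))
    hm.ennreal_ofReal).comp hpm
  have : linStat h = fun X => (∫⁻ x, ENNReal.ofReal (h x) ∂(particleMeasure hD X)).toReal := by
    funext X
    rw [particleMeasure, lintegral_finsetSum_measure, linStat_eq_sum hD X hh,
      ENNReal.toReal_sum (fun x _ => by simp [ENNReal.mul_eq_top])]
    refine Finset.sum_congr rfl fun x _ => ?_
    simp [h0 x]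
  rw [this]
  exact hl.ennreal_toReal

end Configuration

end LinearStatistics

/-! ### Moments and variance of linear statistics. -/

section Variance

open Filter Topology Configuration

theorem mulOp_ae_eq (μ : Measure ℝ) {g : ℝ → ℂ} (hg : IsBddMeasurable g) (f : Lp ℂ 2 μ) :
    mulOp μ g hg f =ᵐ[μ] fun x => g x * f x := by
  have h := (ContinuousLinearMap.mul ℂ ℂ).coeFn_holder (r := 2) ((hg.memLp μ).toLp g) f
  filter_upwards [h, (hg.memLp μ).coeFn_toLp] with x h1 h2
  have h3 : mulOp μ g hg f x = (ContinuousLinearMap.mul ℂ ℂ) ((hg.memLp μ).toLp g x) (f x) := h1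
  rw [h3, h2]
  rfl

theorem mulOp_eq_smul (μ : Measure ℝ) {g₁ g₂ : ℝ → ℂ} (hg₁ : IsBddMeasurable g₁)
    (hg₂ : IsBddMeasurable g₂) (c : ℂ) (h : ∀ x, g₁ x = c * g₂ x) :
    mulOp μ g₁ hg₁ = c • mulOp μ g₂ hg₂ := by
  ext1 f
  refine Lp.ext ?_
  filter_upwards [mulOp_ae_eq μ hg₁ f, mulOp_ae_eq μ hg₂ f,
    Lp.coeFn_smul c (mulOp μ g₂ hg₂ f)] with x h1 h2 h3
  rw [smul_apply, h3, h1, Pi.smul_apply, h2, h, smul_eq_mul, mul_assoc]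

theorem mulOp_mul_mulOp (μ : Measure ℝ) {g₁ g₂ g₃ : ℝ → ℂ} (hg₁ : IsBddMeasurable g₁)
    (hg₂ : IsBddMeasurable g₂) (hg₃ : IsBddMeasurable g₃) (h : ∀ x, g₁ x * g₂ x = g₃ x) :
    mulOp μ g₁ hg₁ * mulOp μ g₂ hg₂ = mulOp μ g₃ hg₃ := by
  ext1 f
  refine Lp.ext ?_
  filter_upwards [mulOp_ae_eq μ hg₁ (mulOp μ g₂ hg₂ f), mulOp_ae_eq μ hg₂ f,
    mulOp_ae_eq μ hg₃ f] with x h1 h2 h3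
  rw [mul_apply_eq_comp, h1, h2, h3, ← h, mul_assoc]

theorem star_mulOp (μ : Measure ℝ) {g : ℝ → ℂ} (hg : IsBddMeasurable g)
    (h : ∀ x, (starRingEnd ℂ) (g x) = g x) : star (mulOp μ g hg) = mulOp μ g hg := by
  rw [ContinuousLinearMap.star_eq_adjoint]
  refine ((ContinuousLinearMap.eq_adjoint_iff _ _).2 fun f₁ f₂ => ?_).symm
  rw [L2.inner_def, L2.inner_def]
  refine integral_congr_ae ?_
  filter_upwards [mulOp_ae_eq μ hg f₁, mulOp_ae_eq μ hg f₂] with x h1 h2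
  rw [h1, h2]
  simp only [RCLike.inner_apply, map_mul, h]
  ring

theorem norm_mulOp_apply_le (μ : Measure ℝ) {g : ℝ → ℂ} (hg : IsBddMeasurable g)
    (h : ∀ x, ‖g x‖ ≤ 1) (f : Lp ℂ 2 μ) : ‖mulOp μ g hg f‖ ≤ ‖f‖ := by
  refine Lp.norm_le_norm_of_ae_le ?_
  filter_upwards [mulOp_ae_eq μ hg f] with x h1
  rw [h1, norm_mul]
  exact mul_le_of_le_one_left (norm_nonneg _) (h x)

theorem eq_zero_of_norm_le_mul {a : ℂ} {k : ℝ} (h : ∀ z : ℝ, 0 < z → z ≤ 1 → ‖a‖ ≤ k * z) :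
    a = 0 := by
  rw [← norm_le_zero_iff]
  have h1 := (tendsto_one_div_add_atTop_nhds_zero_nat (𝕜 := ℝ)).const_mul k
  rw [mul_zero] at h1
  refine ge_of_tendsto' h1 fun n => h _ (by positivity) ?_
  rw [div_le_one (by positivity)]
  linarith [(Nat.cast_nonneg n : (0 : ℝ) ≤ n)]

/-- This matches the determinantal expansion with the probabilistic one. Only `z` in `[0, 1]` is
available, so the coefficients are isolated one at a time by dividing by `z` and letting `z`
decrease to `0`. -/
theorem taylor_coeff_unique {Φ : ℝ → ℂ} {t t' u u' : ℂ} {c c' : ℝ}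
    (h : ∀ z : ℝ, 0 ≤ z → z ≤ 1 → ‖Φ z - (1 + z * t + z ^ 2 * u)‖ ≤ c * z ^ 3)
    (h' : ∀ z : ℝ, 0 ≤ z → z ≤ 1 → ‖Φ z - (1 + z * t' + z ^ 2 * u')‖ ≤ c' * z ^ 3) :
    t = t' ∧ u = u' := by
  have key : ∀ z : ℝ, 0 < z → z ≤ 1 → ‖(t - t') + z * (u - u')‖ ≤ (c + c') * z ^ 2 := by
    intro z h0 h1
    have e1 : (z : ℂ) * ((t - t') + z * (u - u'))
        = (Φ z - (1 + z * t' + z ^ 2 * u')) - (Φ z - (1 + z * t + z ^ 2 * u)) := by ring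
    have e2 := norm_sub_le (Φ z - (1 + z * t' + z ^ 2 * u')) (Φ z - (1 + z * t + z ^ 2 * u))
    rw [← e1, norm_mul, Complex.norm_real, Real.norm_of_nonneg h0.le] at e2
    have := e2.trans (add_le_add (h' z h0.le h1) (h z h0.le h1))
    refine le_of_mul_le_mul_left (this.trans_eq (by ring)) h0
  have ht : t - t' = 0 := by
    refine eq_zero_of_norm_le_mul (k := |c + c'| + ‖u - u'‖) fun z h0 h1 => ?_
    have e1 : t - t' = ((t - t') + z * (u - u')) - z * (u - u') := by ring
    have e2 := norm_sub_le ((t - t') + z * (u - u')) (z * (u - u'))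
    rw [← e1, norm_mul, Complex.norm_real, Real.norm_of_nonneg h0.le] at e2
    have e3 : (c + c') * z ^ 2 ≤ |c + c'| * z := by
      refine mul_le_mul (le_abs_self _) ?_ (by positivity) (abs_nonneg _)
      nlinarith
    linarith [key z h0 h1]
  refine ⟨sub_eq_zero.1 ht, sub_eq_zero.1 ?_⟩
  refine eq_zero_of_norm_le_mul (k := c + c') fun z h0 h1 => ?_
  have := key z h0 h1
  rw [ht, zero_add, norm_mul, Complex.norm_real, Real.norm_of_nonneg h0.le] at this
  exact le_of_mul_le_mul_left (this.trans_eq (by ring)) h0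

theorem isBddMeasurable_ofReal {h : ℝ → ℝ} (hm : Measurable h) (h0 : ∀ x, 0 ≤ h x)
    (h1 : ∀ x, h x ≤ 1) : IsBddMeasurable fun x => (h x : ℂ) := by
  refine ⟨Complex.measurable_ofReal.comp hm, 1, fun x => ?_⟩
  rw [Complex.norm_real, Real.norm_of_nonneg (h0 x)]
  exact h1 x

variable {μ : Measure ℝ} {T : Lp ℂ 2 μ →L[ℂ] Lp ℂ 2 μ} {P : Measure Configuration}
  {D : Set ℝ}

/-- With `g = 1 + χ_D` the summability built into the Fredholm determinant covers the `1 × 1`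
minors, and these are the numbers `‖T χ_D e i‖²`. -/
theorem IsDeterminantal.isHilbertSchmidt (hP : IsDeterminantal μ T P) (hT : IsStarProjection T)
    (hD : IsBounded D) (hDm : MeasurableSet D) {ι : Type} (e : HilbertBasis ι ℂ (Lp ℂ 2 μ)) :
    IsHilbertSchmidt e (T * restrictOp μ D hDm) := by
  have hg : IsBddMeasurable fun x => 1 + D.indicator (fun _ => (1 : ℂ)) x := by
    obtain ⟨C, hC⟩ := (isBddMeasurable_indicator hDm).bounded
    refine ⟨(isBddMeasurable_indicator hDm).measurable.const_add 1, 1 + C, fun x => ?_⟩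
    exact (norm_add_le _ _).trans (by simpa using hC x)
  have h := (hP _ hg D hDm hD (fun x hx => by simp [hx])).2
  rw [mulOp_eq_smul μ hg.sub_one (isBddMeasurable_indicator hDm) 1 (fun x => by simp),
    one_smul] at h
  have hs : Summable (principalMinor e (restrictOp μ D hDm ∘L T ∘L restrictOp μ D hDm)) :=
    (h ι e).summable
  have hs' := (hs.comp_injective (Finset.singleton_injective)).norm
  refine Summable.congr hs' fun i => ?_
  rw [Function.comp, principalMinor_singleton]
  have hTs : star T = T := hT.isSelfAdjoint
  have hTT : T * T = T := hT.isIdempotentElem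
  set R := restrictOp μ D hDm with hR
  have hRs : star R = R := star_mulOp μ _ (fun x => by by_cases hx : x ∈ D <;> simp [hx])
  have : R ∘L T ∘L R = star (T * R) * (T * R) := by
    rw [star_mul, hTs, hRs, mul_assoc, ← mul_assoc T T, hTT]
    rfl
  rw [this, mul_apply_eq_comp, ContinuousLinearMap.star_eq_adjoint,
    ContinuousLinearMap.adjoint_inner_right, inner_self_eq_norm_sq_to_K]
  simp

/-- The multiplicative functional of `1 + 3 χ_D` is `4 ^ count D`; this exponential moment dominates
the expansion errors and the second moments. -/
theorem IsDeterminantal.integrable_pow_count (hP : IsDeterminantal μ T P)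
    (hD : IsBounded D) (hDm : MeasurableSet D) : Integrable (fun X => (4 : ℝ) ^ count D X) P := by
  have hg : IsBddMeasurable fun x => 1 + D.indicator (fun _ => (3 : ℂ)) x := by
    refine ⟨(measurable_const.indicator hDm).const_add 1, 1 + 3, fun x => ?_⟩
    refine (norm_add_le _ _).trans ?_
    by_cases hx : x ∈ D <;> simp [hx]
  have h := (hP _ hg D hDm hD (fun x hx => by simp [hx])).1.norm
  refine h.congr (ae_of_all _ fun X => ?_)
  dsimp only
  rw [multFunctional_one_add_indicator X 3 hD, norm_pow]
  norm_num

variable {h : ℝ → ℝ}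

theorem measurable_linStat (hD : IsBounded D) (hDm : MeasurableSet D) (hm : Measurable h)
    (h0 : ∀ x, 0 ≤ h x) (hh : ∀ x, x ∉ D → h x = 0) : Measurable (linStat h) :=
  measurable_linStat_on hD hDm (Set.subset_univ D) hm h0 hh

theorem sq_count_le (D : Set ℝ) (X : Configuration) : (count D X : ℝ) ^ 2 ≤ 4 ^ count D X := by
  have : (count D X : ℝ) ≤ 2 ^ count D X := by exact_mod_cast Nat.lt_two_pow_self.le
  calc (count D X : ℝ) ^ 2 ≤ (2 ^ count D X) ^ 2 := by gcongr
    _ = 4 ^ count D X := by rw [← pow_mul, mul_comm, pow_mul]; norm_num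

theorem IsDeterminantal.memLp_linStat (hP : IsDeterminantal μ T P)
    (hD : IsBounded D) (hDm : MeasurableSet D) (hm : Measurable h)
    (h0 : ∀ x, 0 ≤ h x) (h1 : ∀ x, h x ≤ 1) (hh : ∀ x, x ∉ D → h x = 0) :
    MemLp (linStat h) 2 P := by
  rw [memLp_two_iff_integrable_sq (measurable_linStat hD hDm hm h0 hh).aestronglyMeasurable]
  refine (hP.integrable_pow_count hD hDm).mono'
    ((measurable_linStat hD hDm hm h0 hh).pow_const 2).aestronglyMeasurable
    (ae_of_all _ fun X => ?_)
  rw [Real.norm_of_nonneg (sq_nonneg _), ← sq_abs]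
  have := abs_linStat_le X hD hh (fun x => abs_le.2 ⟨by linarith [h0 x], h1 x⟩)
  exact (pow_le_pow_left₀ (abs_nonneg _) this 2).trans (sq_count_le D X)

/-- First and second moments of a linear statistic, in terms of traces. -/
theorem IsDeterminantal.moments [IsProbabilityMeasure P] (hP : IsDeterminantal μ T P)
    (hT : IsStarProjection T)
    (hD : IsBounded D) (hDm : MeasurableSet D) (hm : Measurable h)
    (h0 : ∀ x, 0 ≤ h x) (h1 : ∀ x, h x ≤ 1) (hh : ∀ x, x ∉ D → h x = 0)
    {ι : Type} (e : HilbertBasis ι ℂ (Lp ℂ 2 μ)) (A : Lp ℂ 2 μ →L[ℂ] Lp ℂ 2 μ)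
    (hA : A = mulOp μ (fun x => (h x : ℂ)) (isBddMeasurable_ofReal hm h0 h1) * T
      * restrictOp μ D hDm) :
    ∑' i, inner ℂ (e i) (A (e i)) = ((∫ X, linStat h X ∂P : ℝ) : ℂ) ∧
    hsInner e (star A) A = ((∫ X, linStat h X ∂P : ℝ) : ℂ) ^ 2
      - ((∫ X, (linStat h X ^ 2 - linStat (fun x => h x ^ 2) X) ∂P : ℝ) : ℂ) := by
  have hbd := isBddMeasurable_ofReal hm h0 h1
  have hh2 : ∀ x, x ∉ D → h x ^ 2 = 0 := fun x hx => by simp [hh x hx]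
  have h1' : ∀ x, |h x| ≤ 1 := fun x => abs_le.2 ⟨by linarith [h0 x], h1 x⟩
  have hPD := hP.isHilbertSchmidt hT hD hDm e
  have hAHS : IsHilbertSchmidt e A := by
    rw [hA, mul_assoc]
    exact hPD.left_mul _
  have htr : Summable fun i => inner ℂ (e i) (A (e i)) := by
    have hTs : star T = T := hT.isSelfAdjoint
    have hTT : T * T = T := hT.isIdempotentElem
    have hX : star (mulOp μ (fun x => (h x : ℂ)) hbd) = mulOp μ (fun x => (h x : ℂ)) hbd :=
      star_mulOp μ hbd (fun x => Complex.conj_ofReal _)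
    have hDX : restrictOp μ D hDm * mulOp μ (fun x => (h x : ℂ)) hbd
        = mulOp μ (fun x => (h x : ℂ)) hbd :=
      mulOp_mul_mulOp μ _ _ _ fun x => by by_cases hx : x ∈ D <;> simp [hx, hh]
    have hTX : IsHilbertSchmidt e (T * mulOp μ (fun x => (h x : ℂ)) hbd) := by
      have := hPD.right_mul (mulOp μ (fun x => (h x : ℂ)) hbd)
      rwa [mul_assoc, hDX] at this
    refine (hTX.summable_inner hPD).congr fun i => ?_
    -- Splitting `T = T * T` exhibits `A` as a product of two Hilbert–Schmidt operators, hence its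
    -- diagonal is summable.
    have hA' : A = star (T * mulOp μ (fun x => (h x : ℂ)) hbd) * (T * restrictOp μ D hDm) := by
      rw [hA, star_mul, hX, hTs, mul_assoc _ T (T * _), ← mul_assoc T T, hTT, mul_assoc]
    rw [hA', ContinuousLinearMap.star_eq_adjoint]
    exact (ContinuousLinearMap.adjoint_inner_right _ _ _).symm
  have hg : ∀ z : ℝ, IsBddMeasurable fun x => 1 + (z : ℂ) * (h x : ℂ) := by
    intro z
    refine ⟨(hbd.measurable.const_mul _).const_add 1, 1 + |z|, fun x => ?_⟩
    refine (norm_add_le _ _).trans ?_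
    rw [norm_one, norm_mul, Complex.norm_real, Complex.norm_real, Real.norm_eq_abs,
      Real.norm_eq_abs]
    gcongr
    exact mul_le_of_le_one_right (abs_nonneg _) (h1' x)
  have hdet := fun z : ℝ => hP _ (hg z) D hDm hD (fun x hx => by simp [hh x hx])
  have hΦ : ∀ z : ℝ, 0 ≤ z → z ≤ 1 → HasFredholmDet ((z : ℂ) • A)
      (∫ X, multFunctional (fun x => 1 + (z : ℂ) * (h x : ℂ)) X ∂P) := by
    intro z _ _
    have := (hdet z).2
    rw [mulOp_eq_smul μ (hg z).sub_one hbd z (fun x => by ring)] at this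
    rw [hA]
    exact this
  obtain ⟨c, hc⟩ := HasFredholmDet.expansion e hΦ htr.hasSum hAHS.hasSum_mul_swap
  have hS := hP.memLp_linStat hD hDm hm h0 h1 hh
  have hS2 := hP.memLp_linStat hD hDm (h := fun x => h x ^ 2) (hm.pow_const 2)
    (fun x => sq_nonneg _) (fun x => pow_le_one₀ (h0 x) (h1 x)) hh2
  have i1 : Integrable (linStat h) P := hS.integrable one_le_two
  have i2 : Integrable (fun X => linStat h X ^ 2 - linStat (fun x => h x ^ 2) X) P :=
    hS.integrable_sq.sub (hS2.integrable one_le_two)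
  have hexp : ∀ z : ℝ, 0 ≤ z → z ≤ 1 →
      ‖(∫ X, multFunctional (fun x => 1 + (z : ℂ) * (h x : ℂ)) X ∂P)
        - (1 + z * ((∫ X, linStat h X ∂P : ℝ) : ℂ) + z ^ 2 *
          (((∫ X, (linStat h X ^ 2 - linStat (fun x => h x ^ 2) X) ∂P : ℝ) : ℂ) / 2))‖
        ≤ (∫ X, (4 : ℝ) ^ count D X ∂P) * z ^ 3 := by
    intro z hz0 hz1
    have i1' : Integrable (fun X => 1 + z * linStat h X) P :=
      (integrable_const 1).add (i1.const_mul z)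
    have i2' : Integrable (fun X =>
        z ^ 2 * ((linStat h X ^ 2 - linStat (fun x => h x ^ 2) X) / 2)) P :=
      (i2.div_const 2).const_mul (z ^ 2)
    have i3 : Integrable (fun X => 1 + z * linStat h X
        + z ^ 2 * ((linStat h X ^ 2 - linStat (fun x => h x ^ 2) X) / 2)) P := i1'.add i2'
    have e1 : (1 + z * ((∫ X, linStat h X ∂P : ℝ) : ℂ) + z ^ 2 *
          (((∫ X, (linStat h X ^ 2 - linStat (fun x => h x ^ 2) X) ∂P : ℝ) : ℂ) / 2))
        = ∫ X, ((1 + z * linStat h X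
          + z ^ 2 * ((linStat h X ^ 2 - linStat (fun x => h x ^ 2) X) / 2) : ℝ) : ℂ) ∂P := by
      rw [integral_complex_ofReal, integral_add i1' i2',
        integral_add (integrable_const 1) (i1.const_mul z),
        integral_const_mul, integral_const_mul, integral_div]
      simp
    have i4 : Integrable (fun X => ((1 + z * linStat h X
        + z ^ 2 * ((linStat h X ^ 2 - linStat (fun x => h x ^ 2) X) / 2) : ℝ) : ℂ)) P := i3.ofReal
    rw [e1, ← integral_sub (hdet z).1 i4, ← integral_mul_const]
    exact norm_integral_le_of_norm_le ((hP.integrable_pow_count hD hDm).mul_const _)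
      (ae_of_all _ fun X => norm_multFunctional_sub_le X hD hh h1' hz0 hz1)
  obtain ⟨r1, r2⟩ := taylor_coeff_unique hc hexp
  refine ⟨r1, ?_⟩
  rw [r1] at r2
  linear_combination (-2) * r2

/-- The variance of a linear statistic of a determinantal process with projection operator `T` is
half the squared Hilbert–Schmidt norm of the commutator of `T` and the multiplication operator. -/
theorem IsDeterminantal.variance_linStat [IsProbabilityMeasure P] (hP : IsDeterminantal μ T P)
    (hT : IsStarProjection T)
    (hD : IsBounded D) (hDm : MeasurableSet D) (hm : Measurable h)
    (h0 : ∀ x, 0 ≤ h x) (h1 : ∀ x, h x ≤ 1) (hh : ∀ x, x ∉ D → h x = 0)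
    {ι : Type} (e : HilbertBasis ι ℂ (Lp ℂ 2 μ)) (X : Lp ℂ 2 μ →L[ℂ] Lp ℂ 2 μ)
    (hX : X = mulOp μ (fun x => (h x : ℂ)) (isBddMeasurable_ofReal hm h0 h1)) :
    IsHilbertSchmidt e (X * T - T * X) ∧
    ProbabilityTheory.variance (linStat h) P = 1 / 2 * ∑' i, ‖(X * T - T * X) (e i)‖ ^ 2 := by
  have hXs : star X = X := by
    rw [hX]; exact star_mulOp μ _ (fun x => Complex.conj_ofReal _)
  have hDX : restrictOp μ D hDm * X = X := by
    rw [hX]; exact mulOp_mul_mulOp μ _ _ _ fun x => by by_cases hx : x ∈ D <;> simp [hx, hh]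
  have hXD : X * restrictOp μ D hDm = X := by
    rw [hX]; exact mulOp_mul_mulOp μ _ _ _ fun x => by by_cases hx : x ∈ D <;> simp [hx, hh]
  have hDs : star (restrictOp μ D hDm) = restrictOp μ D hDm :=
    star_mulOp μ _ (fun x => by by_cases hx : x ∈ D <;> simp [hx])
  obtain ⟨k1, k2⟩ := re_trace_sub_eq_half_commutator hT hXs hDs hDX hXD
    (hP.isHilbertSchmidt hT hD hDm e)
  refine ⟨k1, ?_⟩
  have hh2 : ∀ x, x ∉ D → h x ^ 2 = 0 := fun x hx => by simp [hh x hx]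
  have hm2 : Measurable fun x => h x ^ 2 := hm.pow_const 2
  have h02 : ∀ x, 0 ≤ h x ^ 2 := fun x => sq_nonneg _
  have h12 : ∀ x, h x ^ 2 ≤ 1 := fun x => pow_le_one₀ (h0 x) (h1 x)
  have hXX : X * X = mulOp μ (fun x => ((h x ^ 2 : ℝ) : ℂ))
      (isBddMeasurable_ofReal hm2 h02 h12) := by
    rw [hX]; exact mulOp_mul_mulOp μ _ _ _ fun x => by push_cast; ring
  obtain ⟨m1, m2⟩ := hP.moments hT hD hDm hm h0 h1 hh e (X * T * restrictOp μ D hDm) (by rw [hX])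
  obtain ⟨m3, -⟩ := hP.moments hT hD hDm hm2 h02 h12 hh2 e
    (X * X * T * restrictOp μ D hDm) (by rw [hXX])
  have hS := hP.memLp_linStat hD hDm hm h0 h1 hh
  have hS2 := hP.memLp_linStat hD hDm hm2 h02 h12 hh2
  -- The second moment found from the determinant counts pairs of distinct particles; the missing
  -- diagonal part is the mean of the statistic of `h²`, supplied by `m3`.
  rw [← k2, m3, m2, ProbabilityTheory.variance_eq_sub hS,
    integral_sub hS.integrable_sq (hS2.integrable one_le_two), Complex.ofReal_re]
  rw [← Complex.ofReal_pow, ← Complex.ofReal_sub, Complex.ofReal_re]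
  simp only [Pi.pow_apply]
  ring

end Variance

/-! ### Hilbert–Schmidt norms of integral kernels. -/

section Kernels

variable {μ : Measure ℝ}

theorem ofReal_norm_sq_eq_lintegral (f : Lp ℂ 2 μ) :
    ENNReal.ofReal (‖f‖ ^ 2) = ∫⁻ x, ‖f x‖ₑ ^ 2 ∂μ := by
  have h := eLpNorm_nnreal_pow_eq_lintegral (f := f) (μ := μ) (p := 2) two_ne_zero
  simp only [NNReal.coe_ofNat, ENNReal.rpow_ofNat, ENNReal.coe_ofNat] at h
  rw [← h, ENNReal.ofReal_pow (norm_nonneg _), ofReal_norm, Lp.enorm_def]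

/-- An operator with a square integrable kernel is Hilbert–Schmidt, with the expected bound. -/
theorem IsIntegralOperator.sum_norm_sq_le [SFinite μ] {κ : ℝ → ℝ → ℂ} {C : Lp ℂ 2 μ →L[ℂ] Lp ℂ 2 μ}
    (hC : IsIntegralOperator μ κ C) (hκ : Measurable (Function.uncurry κ))
    {ι : Type} {e : ι → Lp ℂ 2 μ} (he : Orthonormal ℂ e) (F : Finset ι) :
    ENNReal.ofReal (∑ i ∈ F, ‖C (e i)‖ ^ 2) ≤ ∫⁻ z, ‖κ z.1 z.2‖ₑ ^ 2 ∂(μ.prod μ) := by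
  -- Finiteness of the right side is what makes almost every row of `κ` square integrable.
  by_cases hfin : ∫⁻ z, ‖κ z.1 z.2‖ₑ ^ 2 ∂(μ.prod μ) = ⊤
  · rw [hfin]; exact le_top
  have hm : Measurable fun z : ℝ × ℝ => ‖κ z.1 z.2‖ₑ ^ 2 := hκ.enorm.pow_const 2
  rw [lintegral_prod _ hm.aemeasurable] at hfin ⊢
  have hae : ∀ᵐ x ∂μ, ∫⁻ y, ‖κ x y‖ₑ ^ 2 ∂μ < ⊤ :=
    ae_lt_top hm.lintegral_prod_right' hfin
  rw [ENNReal.ofReal_sum_of_nonneg (fun i _ => by positivity)]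
  simp only [ofReal_norm_sq_eq_lintegral]
  rw [← lintegral_finsetSum' _ fun i _ => ((Lp.aestronglyMeasurable (C (e i))).enorm.pow_const 2)]
  have hCF : ∀ᵐ x ∂μ, ∀ i ∈ F, Integrable (fun y => κ x y * e i y) μ ∧
      C (e i) x = ∫ y, κ x y * e i y ∂μ :=
    (ae_ball_iff F.countable_toSet).2 fun i _ => hC (e i)
  refine lintegral_mono_ae ?_
  filter_upwards [hae, hCF] with x hx1 hx2
  have hmx : Measurable fun y => (starRingEnd ℂ) (κ x y) :=
    Complex.continuous_conj.measurable.comp (hκ.comp measurable_prodMk_left)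
  have hw : MemLp (fun y => (starRingEnd ℂ) (κ x y)) 2 μ := by
    refine ⟨hmx.aestronglyMeasurable, ?_⟩
    have h := eLpNorm_nnreal_pow_eq_lintegral (f := fun y => (starRingEnd ℂ) (κ x y)) (μ := μ)
      (p := 2) two_ne_zero
    simp only [NNReal.coe_ofNat, ENNReal.rpow_ofNat, ENNReal.coe_ofNat, RCLike.enorm_conj] at h
    rw [← h] at hx1
    exact lt_top_iff_ne_top.2 fun h' => by simp [h'] at hx1
  -- For almost every fixed `x`, the values `C (e i) x` are the coefficients of the conjugated row,
  -- so Bessel's inequality applies before integrating in `x`.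
  have hin : ∀ i ∈ F, C (e i) x = inner ℂ (hw.toLp _) (e i) := by
    intro i hi
    rw [(hx2 i hi).2, L2.inner_def]
    refine integral_congr_ae ?_
    filter_upwards [hw.coeFn_toLp] with y hy
    rw [hy]
    simp [mul_comm]
  have hwn : ∫⁻ y, ‖κ x y‖ₑ ^ 2 ∂μ = ENNReal.ofReal (‖hw.toLp _‖ ^ 2) := by
    rw [ofReal_norm_sq_eq_lintegral]
    refine lintegral_congr_ae ?_
    filter_upwards [hw.coeFn_toLp] with y hy
    rw [hy, RCLike.enorm_conj]
  rw [hwn]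
  refine le_trans (le_of_eq ?_) (ENNReal.ofReal_le_ofReal (he.sum_inner_products_le (s := F) _))
  rw [ENNReal.ofReal_sum_of_nonneg (fun i _ => by positivity)]
  refine Finset.sum_congr rfl fun i hi => ?_
  rw [hin i hi, norm_inner_symm, ENNReal.ofReal_pow (norm_nonneg _), ofReal_norm]

theorem IsIntegralOperator.commutator {k : ℝ → ℝ → ℂ} {T : Lp ℂ 2 μ →L[ℂ] Lp ℂ 2 μ}
    (hT : IsIntegralOperator μ k T) {g : ℝ → ℂ} (hg : IsBddMeasurable g) :
    IsIntegralOperator μ (fun x y => (g x - g y) * k x y)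
      (mulOp μ g hg * T - T * mulOp μ g hg) := by
  intro f
  filter_upwards [hT f, hT (mulOp μ g hg f), mulOp_ae_eq μ hg (T f),
    Lp.coeFn_sub ((mulOp μ g hg * T) f) ((T * mulOp μ g hg) f)] with x h1 h2 h3 h4
  have hcongr : (fun y => k x y * mulOp μ g hg f y) =ᵐ[μ] fun y => k x y * (g y * f y) := by
    filter_upwards [mulOp_ae_eq μ hg f] with y hy
    rw [hy]
  have i2 := h2.1.congr hcongr
  have heq : (fun y => (g x - g y) * k x y * f y)
      = fun y => g x * (k x y * f y) - k x y * (g y * f y) := by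
    funext y; ring
  rw [heq]
  refine ⟨(h1.1.const_mul _).sub i2, ?_⟩
  rw [integral_sub (h1.1.const_mul _) i2, integral_const_mul, ← h1.2, ← integral_congr_ae hcongr,
    ← h2.2, sub_apply, h4]
  simp only [Pi.sub_apply, mul_apply_eq_comp]
  rw [h3]

/-- The squared Hilbert–Schmidt norm of an antisymmetric kernel of rank two. -/
theorem lintegral_antisymm_le {va vb : Lp ℂ 2 μ} {N : ℝ}
    (hN : ‖(inner ℂ va vb : ℂ) • va - ((‖va‖ ^ 2 : ℝ) : ℂ) • vb‖ ≤ N * ‖va‖) :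
    ∫⁻ x, ∫⁻ y, ‖va x * vb y - vb x * va y‖ₑ ^ 2 ∂μ ∂μ ≤ ENNReal.ofReal (2 * N ^ 2) := by
  set c : ℂ := inner ℂ va vb with hc
  have hba : inner ℂ vb va = (starRingEnd ℂ) c := (inner_conj_symm _ _).symm
  have hnorm : ∀ α β : ℂ, ‖α • vb - β • va‖ ^ 2
      = ‖α‖ ^ 2 * ‖vb‖ ^ 2 + ‖β‖ ^ 2 * ‖va‖ ^ 2
        - 2 * ((starRingEnd ℂ) α * β * (starRingEnd ℂ) c).re := by
    intro α β
    rw [@norm_sub_sq ℂ, inner_smul_left, inner_smul_right, hba, norm_smul, norm_smul]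
    simp only [RCLike.re_eq_complex_re]
    ring_nf
  -- The vector in `hN` has squared norm `‖va‖²` times the Gram determinant of `va`, `vb`, so its
  -- bound controls that determinant by `N²`.
  have hgram : ‖va‖ ^ 2 * ‖vb‖ ^ 2 - ‖c‖ ^ 2 ≤ N ^ 2 := by
    by_cases h0 : ‖va‖ = 0
    · rw [h0]
      nlinarith [norm_nonneg c]
    have h1 : ‖c • va - ((‖va‖ ^ 2 : ℝ) : ℂ) • vb‖ ^ 2
        = ‖va‖ ^ 2 * (‖va‖ ^ 2 * ‖vb‖ ^ 2 - ‖c‖ ^ 2) := by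
      rw [norm_sub_rev, hnorm, Complex.norm_real, Complex.conj_ofReal, mul_assoc, Complex.mul_conj,
        Complex.normSq_eq_norm_sq, ← Complex.ofReal_mul, Complex.ofReal_re,
        Real.norm_of_nonneg (sq_nonneg _)]
      ring
    have h2 := pow_le_pow_left₀ (norm_nonneg _) hN 2
    rw [h1, mul_pow, mul_comm] at h2
    exact le_of_mul_le_mul_right h2 (by positivity)
  -- For fixed `x` the integral in `y` is the squared norm of a combination of `va` and `vb`;
  -- integrating in `x` then yields twice the Gram determinant.
  have hinner : ∀ α β : ℂ, ∫⁻ y, ‖α * vb y - β * va y‖ₑ ^ 2 ∂μ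
      = ENNReal.ofReal (‖α • vb - β • va‖ ^ 2) := by
    intro α β
    rw [ofReal_norm_sq_eq_lintegral]
    refine lintegral_congr_ae ?_
    filter_upwards [Lp.coeFn_sub (α • vb) (β • va), Lp.coeFn_smul α vb, Lp.coeFn_smul β va]
      with y h1 h2 h3
    rw [h1, Pi.sub_apply, h2, h3]
    rfl
  simp only [hinner]
  have ia : Integrable (fun x => ‖va x‖ ^ 2) μ := (Lp.memLp va).integrable_norm_pow (by norm_num)
  have ib : Integrable (fun x => ‖vb x‖ ^ 2) μ := (Lp.memLp vb).integrable_norm_pow (by norm_num)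
  have iab : Integrable (fun x => (starRingEnd ℂ) (va x) * vb x) μ := by
    refine (L2.integrable_inner (𝕜 := ℂ) va vb).congr (Filter.Eventually.of_forall fun x => ?_)
    simp [mul_comm]
  have hnsq : ∀ v : Lp ℂ 2 μ, ∫ x, ‖v x‖ ^ 2 ∂μ = ‖v‖ ^ 2 := by
    intro v
    have h := inner_self_eq_norm_sq_to_K (𝕜 := ℂ) v
    rw [L2.inner_def] at h
    have h2 : (fun x => inner ℂ (v x) (v x)) = fun x => ((‖v x‖ ^ 2 : ℝ) : ℂ) := by
      funext x
      rw [inner_self_eq_norm_sq_to_K]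
      simp
    rw [h2, integral_complex_ofReal] at h
    exact Complex.ofReal_injective (h.trans (by simp))
  have hiab : ∫ x, (starRingEnd ℂ) (va x) * vb x ∂μ = c := by
    rw [hc, L2.inner_def]
    refine integral_congr_ae (Filter.Eventually.of_forall fun x => ?_)
    simp [mul_comm]
  have ire : Integrable (fun x =>
      ((starRingEnd ℂ) (va x) * vb x * (starRingEnd ℂ) c).re) μ :=
    (iab.mul_const _).re
  have iadd : Integrable (fun x => ‖va x‖ ^ 2 * ‖vb‖ ^ 2 + ‖vb x‖ ^ 2 * ‖va‖ ^ 2) μ :=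
    (ia.mul_const _).add (ib.mul_const _)
  have itot : Integrable (fun x => ‖va x • vb - vb x • va‖ ^ 2) μ := by
    simp only [hnorm]
    exact iadd.sub (ire.const_mul 2)
  have hval : ∫ x, ‖va x • vb - vb x • va‖ ^ 2 ∂μ
      = 2 * (‖va‖ ^ 2 * ‖vb‖ ^ 2 - ‖c‖ ^ 2) := by
    simp only [hnorm]
    rw [integral_sub iadd (ire.const_mul 2),
      integral_add (ia.mul_const _) (ib.mul_const _), integral_mul_const, integral_mul_const,
      hnsq, hnsq, integral_const_mul]
    have : ∫ x, ((starRingEnd ℂ) (va x) * vb x * (starRingEnd ℂ) c).re ∂μ = ‖c‖ ^ 2 := by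
      have h := integral_re (iab.mul_const ((starRingEnd ℂ) c))
      simp only [RCLike.re_eq_complex_re] at h
      rw [h, integral_mul_const, hiab, Complex.mul_conj, Complex.normSq_eq_norm_sq,
        Complex.ofReal_re]
    rw [this]
    ring
  rw [← ofReal_integral_eq_lintegral_ofReal itot
    (Filter.Eventually.of_forall fun x => sq_nonneg _), hval]
  exact ENNReal.ofReal_le_ofReal (by linarith)

end Kernels

/-! ### Uniform energy bounds for cutoffs at all scales. -/

section Energy

open Filter Topology

variable {μ : Measure ℝ}

/-- The double integral of `|h x - h y|² |k x y|²`. -/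
noncomputable def kernelEnergy (μ : Measure ℝ) (k : ℝ → ℝ → ℂ) (h : ℝ → ℂ) : ENNReal :=
  ∫⁻ z, ‖(h z.1 - h z.2) * k z.1 z.2‖ₑ ^ 2 ∂(μ.prod μ)

/-- The kernel `(a x b y - b x a y) / (x - y)`. -/
noncomputable def integrableKernel (a b : ℝ → ℂ) (x y : ℝ) : ℂ :=
  (a x * b y - b x * a y) / ((x : ℂ) - (y : ℂ))

theorem measurable_integrableKernel {a b : ℝ → ℂ} (ha : Measurable a) (hb : Measurable b) :
    Measurable (Function.uncurry (integrableKernel a b)) := by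
  have h1 : Measurable fun z : ℝ × ℝ => (z.1 : ℂ) := Complex.measurable_ofReal.comp measurable_fst
  have h2 : Measurable fun z : ℝ × ℝ => (z.2 : ℂ) := Complex.measurable_ofReal.comp measurable_snd
  exact (((ha.comp measurable_fst).mul (hb.comp measurable_snd)).sub
    ((hb.comp measurable_fst).mul (ha.comp measurable_snd))).div (h1.sub h2)

theorem sq_add_sq_le_normSq (M x : ℝ) : ‖(x : ℂ) + M * Complex.I‖ ^ 2 = x ^ 2 + M ^ 2 := by
  rw [← Complex.normSq_eq_norm_sq, Complex.normSq_add_mul_I]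

/-- The Möbius function `iM / (x + iM)`. -/
noncomputable def moebiusCutoff (M : ℝ) (x : ℝ) : ℂ := M * Complex.I / (x + M * Complex.I)

variable {M : ℝ}

theorem le_norm_add_mul_I (M : ℝ) (x : ℝ) : M ≤ ‖(x : ℂ) + M * Complex.I‖ := by
  refine le_of_sq_le_sq ?_ (norm_nonneg _)
  rw [sq_add_sq_le_normSq]
  nlinarith [sq_nonneg x]

theorem add_mul_I_ne_zero (hM : 0 < M) (x : ℝ) : (x : ℂ) + M * Complex.I ≠ 0 := by
  rw [← norm_pos_iff]
  exact hM.trans_le (le_norm_add_mul_I M x)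

theorem norm_moebiusCutoff_le (hM : 0 < M) (x : ℝ) : ‖moebiusCutoff M x‖ ≤ 1 := by
  rw [moebiusCutoff, norm_div, norm_mul, Complex.norm_I, Complex.norm_real, mul_one,
    Real.norm_of_nonneg hM.le]
  exact div_le_one_of_le₀ (le_norm_add_mul_I M x) (norm_nonneg _)

theorem isBddMeasurable_moebiusCutoff (hM : 0 < M) : IsBddMeasurable (moebiusCutoff M) :=
  ⟨measurable_const.div (Complex.measurable_ofReal.add_const _), 1, norm_moebiusCutoff_le hM⟩

theorem moebiusCutoff_re (M : ℝ) (x : ℝ) :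
    (moebiusCutoff M x).re = M ^ 2 / (x ^ 2 + M ^ 2) := by
  have h : Complex.normSq ((x : ℂ) + M * Complex.I) = x ^ 2 + M ^ 2 := Complex.normSq_add_mul_I x M
  rw [moebiusCutoff, Complex.div_re, h]
  simp
  ring

/-- `φ x - φ y = iM (y - x) / ((x + iM) (y + iM))`, so the singular denominator cancels and an
antisymmetric kernel of rank two remains. -/
theorem moebiusCutoff_sub_mul_kernel (hM : 0 < M) (a b : ℝ → ℂ) {x y : ℝ} (hxy : y ≠ x) :
    (moebiusCutoff M x - moebiusCutoff M y) * integrableKernel a b x y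
      = -((a x / (x + M * Complex.I)) * (M * Complex.I * b y / (y + M * Complex.I))
        - (M * Complex.I * b x / (x + M * Complex.I)) * (a y / (y + M * Complex.I))) := by
  have h1 := add_mul_I_ne_zero hM x
  have h2 := add_mul_I_ne_zero hM y
  have h3 : (x : ℂ) - y ≠ 0 := sub_ne_zero.2 fun h => hxy (Complex.ofReal_injective h).symm
  unfold moebiusCutoff integrableKernel
  field_simp
  ring

/-- The part of the line on which `a`, `b` and the position are bounded by `n`. -/
def boundedPart (a b : ℝ → ℂ) (n : ℕ) : Set ℝ := {x | ‖a x‖ ≤ n ∧ ‖b x‖ ≤ n ∧ |x| ≤ n}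

theorem measurableSet_boundedPart {a b : ℝ → ℂ} (ha : Measurable a) (hb : Measurable b) (n : ℕ) :
    MeasurableSet (boundedPart a b n) :=
  (measurableSet_le ha.norm measurable_const).inter
    ((measurableSet_le hb.norm measurable_const).inter
      (measurableSet_le measurable_norm measurable_const))

theorem boundedPart_mono (a b : ℝ → ℂ) : Monotone (boundedPart a b) := by
  intro n m hnm x hx
  have : (n : ℝ) ≤ m := by exact_mod_cast hnm
  exact ⟨hx.1.trans this, hx.2.1.trans this, hx.2.2.trans this⟩

theorem exists_mem_boundedPart (a b : ℝ → ℂ) (x : ℝ) : ∃ n, x ∈ boundedPart a b n := by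
  obtain ⟨n, hn⟩ := exists_nat_ge (max ‖a x‖ (max ‖b x‖ |x|))
  exact ⟨n, (le_max_left _ _).trans hn, ((le_max_left _ _).trans (le_max_right _ _)).trans hn,
    ((le_max_right _ _).trans (le_max_right _ _)).trans hn⟩

theorem measure_boundedPart_lt_top [IsLocallyFiniteMeasure μ] (a b : ℝ → ℂ) (n : ℕ) :
    μ (boundedPart a b n) < ⊤ := by
  refine (measure_mono fun x hx => ?_).trans_lt (measure_closedBall_lt_top (x := (0 : ℝ)) (r := n))
  rw [Metric.mem_closedBall, dist_zero_right]
  exact hx.2.2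

theorem memLp_indicator_of_bound {s : Set ℝ} (hs : MeasurableSet s) (hμ : μ s < ⊤) {f : ℝ → ℂ}
    (hf : Measurable f) (c : ℝ) (hc : ∀ x ∈ s, ‖f x‖ ≤ c) : MemLp (s.indicator f) 2 μ := by
  rw [memLp_indicator_iff_restrict hs]
  have : IsFiniteMeasure (μ.restrict s) := ⟨by simpa using hμ⟩
  exact MemLp.of_bound hf.aestronglyMeasurable c (ae_restrict_of_forall_mem hs hc)

/-- The commutator of a projection with integrable kernel and the multiplication by
`iM / (x + iM)` is of rank at most two, hence of bounded Hilbert–Schmidt norm. -/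
theorem kernelEnergy_moebiusCutoff_le [SigmaFinite μ] [IsLocallyFiniteMeasure μ] [NullSingletonClass μ]
    {a b : ℝ → ℂ} (ha : Measurable a) (hb : Measurable b) {T : Lp ℂ 2 μ →L[ℂ] Lp ℂ 2 μ}
    (hT : IsIntegralOperator μ (integrableKernel a b) T) (hT1 : ‖T‖ ≤ 1) (hM : 0 < M) :
    kernelEnergy μ (integrableKernel a b) (moebiusCutoff M) ≤ 8 := by
  set φ := moebiusCutoff M with hφ
  have hφb := isBddMeasurable_moebiusCutoff hM
  -- The functions `α`, `β` are not known to be square integrable; truncation to `Q n` makes them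
  -- so, with an energy bound independent of `n`.
  set Q := boundedPart a b with hQ
  have hQm := measurableSet_boundedPart ha hb
  set α : ℝ → ℂ := fun x => a x / (x + M * Complex.I) with hα
  set β : ℝ → ℂ := fun x => M * Complex.I * b x / (x + M * Complex.I) with hβ
  have hden : Measurable fun x : ℝ => (x : ℂ) + M * Complex.I :=
    Complex.measurable_ofReal.add_const _
  have hαm : Measurable α := ha.div hden
  have hβm : Measurable β := (hb.const_mul _).div hden
  set C := mulOp μ φ hφb * T - T * mulOp μ φ hφb with hC
  have hCn : ∀ f, ‖C f‖ ≤ 2 * ‖f‖ := by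
    intro f
    have hX : ∀ f, ‖mulOp μ φ hφb f‖ ≤ ‖f‖ := norm_mulOp_apply_le μ hφb (norm_moebiusCutoff_le hM)
    have hTn : ∀ f, ‖T f‖ ≤ ‖f‖ := fun f => by simpa using T.le_of_opNorm_le hT1 f
    calc ‖C f‖ ≤ ‖mulOp μ φ hφb (T f)‖ + ‖T (mulOp μ φ hφb f)‖ := norm_sub_le _ _
      _ ≤ ‖f‖ + ‖f‖ := add_le_add ((hX _).trans (hTn _)) ((hTn _).trans (hX _))
      _ = 2 * ‖f‖ := by ring
  have hCk := hT.commutator hφb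
  have hkey : ∀ n, ∫⁻ z in Q n ×ˢ Q n, ‖(φ z.1 - φ z.2) * integrableKernel a b z.1 z.2‖ₑ ^ 2
      ∂(μ.prod μ) ≤ 8 := by
    intro n
    have hμQ := measure_boundedPart_lt_top (μ := μ) a b n
    have hLa : MemLp ((Q n).indicator α) 2 μ := by
      refine memLp_indicator_of_bound (hQm n) hμQ hαm (n / M) fun x hx => ?_
      rw [hα, norm_div]
      exact div_le_div₀ (Nat.cast_nonneg n) hx.1 hM (le_norm_add_mul_I M x)
    have hLb : MemLp ((Q n).indicator β) 2 μ := by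
      refine memLp_indicator_of_bound (hQm n) hμQ hβm (M * n / M) fun x hx => ?_
      simp only [hβ, norm_div, norm_mul, Complex.norm_I, Complex.norm_real, mul_one,
        Real.norm_of_nonneg hM.le]
      exact div_le_div₀ (by positivity) (by gcongr; exact hx.2.1) hM (le_norm_add_mul_I M x)
    -- The commutator is tested on the conjugate of the truncated `α`, which turns its kernel into
    -- the inner products of `va` with `vb` and with itself.
    have hLc : MemLp (fun x => (starRingEnd ℂ) ((Q n).indicator α x)) 2 μ := hLa.star
    set va := hLa.toLp _ with hva
    set vb := hLb.toLp _ with hvb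
    set f := hLc.toLp _ with hf
    have hva' : va =ᵐ[μ] (Q n).indicator α := hLa.coeFn_toLp
    have hvb' : vb =ᵐ[μ] (Q n).indicator β := hLb.coeFn_toLp
    have hf' : f =ᵐ[μ] fun x => (starRingEnd ℂ) ((Q n).indicator α x) := hLc.coeFn_toLp
    have hfn : ‖f‖ ≤ ‖va‖ := by
      refine Lp.norm_le_norm_of_ae_le ?_
      filter_upwards [hva', hf'] with x h1 h2
      rw [h1, h2, RCLike.norm_conj]
    have hinn : ∀ v w : Lp ℂ 2 μ, ∀ g : ℝ → ℂ, w =ᵐ[μ] g → v =ᵐ[μ] (Q n).indicator α →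
        Integrable (fun y => g y * (starRingEnd ℂ) ((Q n).indicator α y)) μ ∧
        ∫ y, g y * (starRingEnd ℂ) ((Q n).indicator α y) ∂μ = inner ℂ v w := by
      intro v w g hg hv
      have : (fun y => inner ℂ (v y) (w y))
          =ᵐ[μ] fun y => g y * (starRingEnd ℂ) ((Q n).indicator α y) := by
        filter_upwards [hg, hv] with y h1 h2
        rw [h1, h2, RCLike.inner_apply]
      exact ⟨(L2.integrable_inner (𝕜 := ℂ) v w).congr this, by
        rw [L2.inner_def]; exact (integral_congr_ae this).symm⟩
    obtain ⟨i1, j1⟩ := hinn va vb _ hvb' hva'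
    obtain ⟨i2, j2⟩ := hinn va va _ hva' hva'
    -- On `Q n` the vector agrees with `C f` up to sign and off `Q n` it vanishes, so `‖C f‖ ≤ 2
    -- ‖f‖` gives the hypothesis of `lintegral_antisymm_le` with `N = 2`.
    have hcomb : ‖(inner ℂ va vb : ℂ) • va - ((‖va‖ ^ 2 : ℝ) : ℂ) • vb‖ ≤ 2 * ‖va‖ := by
      refine le_trans (Lp.norm_le_norm_of_ae_le ?_) ((hCn f).trans (by gcongr))
      filter_upwards [hCk f, hva', hvb', Lp.coeFn_sub ((inner ℂ va vb : ℂ) • va)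
        (((‖va‖ ^ 2 : ℝ) : ℂ) • vb), Lp.coeFn_smul (inner ℂ va vb : ℂ) va,
        Lp.coeFn_smul ((‖va‖ ^ 2 : ℝ) : ℂ) vb] with x h1 h2 h3 h4 h5 h6
      rw [h4, Pi.sub_apply, h5, h6, Pi.smul_apply, Pi.smul_apply, h2, h3]
      by_cases hx : x ∈ Q n
      · have hint : ∫ y, (φ x - φ y) * integrableKernel a b x y * f y ∂μ
            = -((Q n).indicator α x * inner ℂ va vb - (Q n).indicator β x * inner ℂ va va) := by
          rw [← j1, ← j2, ← integral_const_mul, ← integral_const_mul,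
            ← integral_sub (i1.const_mul _) (i2.const_mul _), ← integral_neg]
          refine integral_congr_ae ?_
          have hne : ∀ᵐ y ∂μ, y ≠ x := by
            rw [ae_iff]; simp
          filter_upwards [hf', hne] with y hy hyx
          rw [hy, hφ, moebiusCutoff_sub_mul_kernel hM a b hyx]
          by_cases hyQ : y ∈ Q n
          · simp only [Set.indicator_of_mem hx, Set.indicator_of_mem hyQ]
            ring
          · simp [Set.indicator_of_notMem hyQ]
        rw [h1.2, hint, inner_self_eq_norm_sq_to_K, norm_neg]
        refine le_of_eq (congrArg norm ?_)
        simp only [smul_eq_mul, Complex.ofReal_pow, Complex.coe_algebraMap]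
        ring
      · simp [Set.indicator_of_notMem hx]
    have hrank := lintegral_antisymm_le (μ := μ) hcomb
    have h8 : ENNReal.ofReal (2 * 2 ^ 2) = 8 := by
      rw [show (2 * 2 ^ 2 : ℝ) = ((8 : ℕ) : ℝ) by norm_num, ENNReal.ofReal_natCast]; rfl
    rw [h8] at hrank
    refine le_trans ?_ hrank
    have hmeas : Measurable fun z : ℝ × ℝ =>
        ‖(φ z.1 - φ z.2) * integrableKernel a b z.1 z.2‖ₑ ^ 2 :=
      ((((hφb.measurable.comp measurable_fst).sub (hφb.measurable.comp measurable_snd)).mul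
        (measurable_integrableKernel ha hb)).enorm.pow_const 2)
    rw [← lintegral_indicator ((hQm n).prod (hQm n)),
      lintegral_prod _ (hmeas.indicator ((hQm n).prod (hQm n))).aemeasurable]
    refine lintegral_mono_ae ?_
    filter_upwards [hva', hvb'] with x hx1 hx2
    have hne : ∀ᵐ y ∂μ, y ≠ x := by
      rw [ae_iff]; simp
    refine lintegral_mono_ae ?_
    filter_upwards [hva', hvb', hne] with y hy1 hy2 hyx
    by_cases hmem : (x, y) ∈ Q n ×ˢ Q n
    · rw [Set.indicator_of_mem hmem, hx1, hx2, hy1, hy2, Set.indicator_of_mem hmem.1,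
        Set.indicator_of_mem hmem.2, Set.indicator_of_mem hmem.1, Set.indicator_of_mem hmem.2]
      simp only
      rw [hφ, moebiusCutoff_sub_mul_kernel hM a b hyx, enorm_neg]
    · rw [Set.indicator_of_notMem hmem]
      exact zero_le
  have hmono : Monotone fun n => Q n ×ˢ Q n := fun n m h =>
    Set.prod_mono (boundedPart_mono a b h) (boundedPart_mono a b h)
  have huniv : ⋃ n, Q n ×ˢ Q n = Set.univ := by
    refine Set.eq_univ_of_forall fun z => Set.mem_iUnion.2 ?_
    obtain ⟨n, hn⟩ := exists_mem_boundedPart a b z.1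
    obtain ⟨m, hm⟩ := exists_mem_boundedPart a b z.2
    exact ⟨max n m, boundedPart_mono a b (le_max_left _ _) hn,
      boundedPart_mono a b (le_max_right _ _) hm⟩
  -- The squares `Q n ×ˢ Q n` exhaust the plane, so monotone convergence removes the truncation.
  rw [kernelEnergy, ← setLIntegral_univ, ← huniv,
    setLIntegral_iUnion_of_directed _ hmono.directed_le]
  exact iSup_le hkey

/-- A cutoff that equals `1` on `[-M, M]` and vanishes off `[-2M, 2M]`. -/
noncomputable def cutoff (M : ℝ) (x : ℝ) : ℝ :=
  max 0 (min 1 (4 * (M ^ 2 / (x ^ 2 + M ^ 2)) - 1))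

theorem cutoff_nonneg (M x : ℝ) : 0 ≤ cutoff M x := le_max_left _ _

theorem cutoff_le_one (M x : ℝ) : cutoff M x ≤ 1 := max_le zero_le_one (min_le_left _ _)

theorem measurable_cutoff (M : ℝ) : Measurable (cutoff M) := by
  unfold cutoff
  fun_prop

theorem cutoff_eq_one (hM : 0 < M) {x : ℝ} (hx : |x| ≤ M) : cutoff M x = 1 := by
  have h1 : x ^ 2 ≤ M ^ 2 := sq_le_sq' (abs_le.1 hx).1 (abs_le.1 hx).2
  have h2 : 1 / 2 ≤ M ^ 2 / (x ^ 2 + M ^ 2) := by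
    rw [div_le_div_iff₀ two_pos (by positivity)]
    linarith
  rw [cutoff, min_eq_left (by linarith), max_eq_right zero_le_one]

theorem cutoff_eq_zero (hM : 0 < M) {x : ℝ} (hx : 2 * M ≤ |x|) : cutoff M x = 0 := by
  have h1 : (2 * M) ^ 2 ≤ x ^ 2 := by
    rw [← sq_abs x]; exact pow_le_pow_left₀ (by positivity) hx 2
  have h2 : M ^ 2 / (x ^ 2 + M ^ 2) ≤ 1 / 4 := by
    rw [div_le_div_iff₀ (by positivity) (by norm_num)]
    nlinarith
  rw [cutoff, max_eq_left]
  exact (min_le_right _ _).trans (by linarith)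

/-- The cutoff clamps `4 Re φ - 1` to `[0, 1]`; clamping and taking real parts do not increase
distances. -/
theorem abs_cutoff_sub_le (M : ℝ) (x y : ℝ) :
    |cutoff M x - cutoff M y| ≤ 4 * ‖moebiusCutoff M x - moebiusCutoff M y‖ := by
  have h1 : |cutoff M x - cutoff M y|
      ≤ |(4 * (M ^ 2 / (x ^ 2 + M ^ 2)) - 1) - (4 * (M ^ 2 / (y ^ 2 + M ^ 2)) - 1)| := by
    unfold cutoff
    refine (abs_max_sub_max_le_max _ _ _ _).trans ?_
    rw [sub_self, abs_zero]
    refine max_le (abs_nonneg _) ((abs_min_sub_min_le_max _ _ _ _).trans ?_)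
    rw [sub_self, abs_zero]
    exact max_le (abs_nonneg _) le_rfl
  refine h1.trans ?_
  have h2 := Complex.abs_re_le_norm (moebiusCutoff M x - moebiusCutoff M y)
  rw [Complex.sub_re, moebiusCutoff_re M, moebiusCutoff_re M] at h2
  rw [sub_sub_sub_cancel_right, ← mul_sub, abs_mul, abs_of_pos (four_pos : (0 : ℝ) < 4)]
  gcongr

/-- The Lipschitz constant `4` enters squared: `128 = 4² * 8`. -/
theorem kernelEnergy_cutoff_le {k : ℝ → ℝ → ℂ}
    (hk : kernelEnergy μ k (moebiusCutoff M) ≤ 8) :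
    kernelEnergy μ k (fun x => (cutoff M x : ℂ)) ≤ 128 := by
  have h : kernelEnergy μ k (fun x => (cutoff M x : ℂ))
      ≤ 16 * kernelEnergy μ k (moebiusCutoff M) := by
    unfold kernelEnergy
    rw [← lintegral_const_mul' _ _ (by simp)]
    refine lintegral_mono fun z => ?_
    have h16 : (16 : ENNReal) = 4 ^ 2 := by norm_num
    rw [h16, ← mul_pow]
    refine pow_le_pow_left₀ zero_le ?_ 2
    rw [enorm_mul, enorm_mul, ← mul_assoc]
    gcongr
    have h4 : (4 : ENNReal) = ENNReal.ofReal 4 := by simp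
    rw [← ofReal_norm, ← ofReal_norm, h4, ← ENNReal.ofReal_mul (by norm_num)]
    refine ENNReal.ofReal_le_ofReal ?_
    rw [← Complex.ofReal_sub, Complex.norm_real]
    exact abs_cutoff_sub_le M _ _
  calc _ ≤ _ := h
    _ ≤ 16 * 8 := by gcongr
    _ = 128 := by norm_num

end Energy

/-! ### Averaging over separated scales. -/

section Averages

open Filter Topology

variable {μ : Measure ℝ}

/-- The sum of the cutoffs at the scales `2 ^ m`, `m ∈ s`. -/
noncomputable def cutoffSum (s : Finset ℕ) (x : ℝ) : ℝ := ∑ m ∈ s, cutoff (2 ^ m) x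

theorem cutoffSum_nonneg (s : Finset ℕ) (x : ℝ) : 0 ≤ cutoffSum s x :=
  Finset.sum_nonneg fun _ _ => cutoff_nonneg _ _

theorem cutoffSum_le (s : Finset ℕ) (x : ℝ) : cutoffSum s x ≤ s.card := by
  simpa [cutoffSum] using Finset.sum_le_sum fun m (_ : m ∈ s) => cutoff_le_one (2 ^ m) x

theorem measurable_cutoffSum (s : Finset ℕ) : Measurable (cutoffSum s) :=
  Finset.measurable_fun_sum s fun _ _ => measurable_cutoff _

theorem cutoffSum_eq_zero {s : Finset ℕ} {p : ℕ} (hp : ∀ m ∈ s, m ≤ p) {x : ℝ}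
    (hx : 2 ^ (p + 1) ≤ |x|) : cutoffSum s x = 0 := by
  refine Finset.sum_eq_zero fun m hm => cutoff_eq_zero (by positivity) (le_trans ?_ hx)
  rw [← pow_succ']
  exact pow_le_pow_right₀ one_le_two (Nat.succ_le_succ (hp m hm))

theorem cutoffSum_eq_card {s : Finset ℕ} {N : ℕ} (hN : ∀ m ∈ s, N ≤ m) {x : ℝ}
    (hx : |x| ≤ 2 ^ N) : cutoffSum s x = s.card := by
  rw [cutoffSum, Finset.sum_congr rfl fun m hm => cutoff_eq_one (by positivity)
    (hx.trans (pow_le_pow_right₀ one_le_two (hN m hm)))]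
  simp

theorem kernelEnergy_ofReal (k : ℝ → ℝ → ℂ) (h : ℝ → ℝ) :
    kernelEnergy μ k (fun x => (h x : ℂ))
      = ∫⁻ z, ENNReal.ofReal (|h z.1 - h z.2| ^ 2) * ‖k z.1 z.2‖ₑ ^ 2 ∂(μ.prod μ) := by
  refine lintegral_congr fun z => ?_
  rw [enorm_mul, mul_pow, ← Complex.ofReal_sub, ← ofReal_norm, Complex.norm_real,
    Real.norm_eq_abs, ENNReal.ofReal_pow (abs_nonneg _)]

/-- If both increments are nonzero, one point lies inside radius `2 ^ (p + 1)` and the other outside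
radius `2 ^ n ≥ 2 ^ (p + 2)`. The cutoff at scale `2 ^ (p + 1)` then jumps from `1` to `0`, so it
gives a majorant independent of `n`. -/
theorem cutoff_cross_le {s : Finset ℕ} {p n : ℕ} (hp : ∀ m ∈ s, m ≤ p) (hn : p + 2 ≤ n) (x y : ℝ) :
    |cutoffSum s x - cutoffSum s y| * |cutoff (2 ^ n) x - cutoff (2 ^ n) y|
      ≤ s.card * |cutoff (2 ^ (p + 1)) x - cutoff (2 ^ (p + 1)) y| ^ 2 := by
  wlog hxy : |x| ≤ |y| generalizing x y
  · have := this y x (le_of_not_ge hxy)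
    rwa [abs_sub_comm (cutoffSum s y), abs_sub_comm (cutoff (2 ^ n) y),
      abs_sub_comm (cutoff (2 ^ (p + 1)) y)] at this
  have hpow : (2 : ℝ) ^ (p + 2) ≤ 2 ^ n := pow_le_pow_right₀ one_le_two hn
  rcases le_or_gt (2 ^ (p + 1)) |x| with hx | hx
  · rw [cutoffSum_eq_zero hp hx, cutoffSum_eq_zero hp (hx.trans hxy)]
    simp only [sub_self, abs_zero, zero_mul]
    positivity
  rcases le_or_gt |y| (2 ^ n) with hy | hy
  · rw [cutoff_eq_one (by positivity) (hxy.trans hy), cutoff_eq_one (by positivity) hy]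
    simp only [sub_self, abs_zero, mul_zero]
    positivity
  · rw [cutoff_eq_one (by positivity) hx.le, cutoff_eq_zero (M := 2 ^ (p + 1)) (by positivity)
      (by rw [← pow_succ']; exact hpow.trans hy.le)]
    rw [sub_zero, abs_one, one_pow]
    refine mul_le_mul ?_ ?_ (abs_nonneg _) (Nat.cast_nonneg _)
    · exact abs_sub_le_of_nonneg_of_le (cutoffSum_nonneg s x) (cutoffSum_le s x)
        (cutoffSum_nonneg s y) (cutoffSum_le s y)
    · exact abs_sub_le_of_nonneg_of_le (cutoff_nonneg _ x) (cutoff_le_one _ x)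
        (cutoff_nonneg _ y) (cutoff_le_one _ y)

/-- Cutoffs at distant scales are almost orthogonal. -/
theorem tendsto_cross_energy {k : ℝ → ℝ → ℂ} (hk : Measurable (Function.uncurry k))
    (hE : ∀ M : ℝ, 0 < M → kernelEnergy μ k (fun x => (cutoff M x : ℂ)) ≤ 128) (s : Finset ℕ) :
    Tendsto (fun n : ℕ => ∫⁻ z, ENNReal.ofReal (|cutoffSum s z.1 - cutoffSum s z.2| *
      |cutoff (2 ^ n) z.1 - cutoff (2 ^ n) z.2|) * ‖k z.1 z.2‖ₑ ^ 2 ∂(μ.prod μ)) atTop (𝓝 0) := by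
  obtain ⟨p, hp⟩ := s.exists_le
  have hmd : ∀ h : ℝ → ℝ, Measurable h → Measurable fun z : ℝ × ℝ => |h z.1 - h z.2| :=
    fun h hh => ((hh.comp measurable_fst).sub (hh.comp measurable_snd)).abs
  have hkm : Measurable fun z : ℝ × ℝ => ‖k z.1 z.2‖ₑ ^ 2 := hk.enorm.pow_const 2
  rw [← lintegral_zero (μ := μ.prod μ)]
  -- The majorant has finite energy by `hE` at the single scale `2 ^ (p + 1)`; pointwise, large
  -- cutoffs equal `1` at both points.
  refine tendsto_lintegral_filter_of_dominated_convergence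
    (fun z => ENNReal.ofReal (s.card * |cutoff (2 ^ (p + 1)) z.1 - cutoff (2 ^ (p + 1)) z.2| ^ 2)
      * ‖k z.1 z.2‖ₑ ^ 2) ?_ ?_ ?_ ?_
  · exact Eventually.of_forall fun n =>
      (((hmd _ (measurable_cutoffSum s)).mul (hmd _ (measurable_cutoff _))).ennreal_ofReal).mul hkm
  · filter_upwards [eventually_ge_atTop (p + 2)] with n hn
    refine ae_of_all _ fun z => ?_
    exact mul_le_mul_left (ENNReal.ofReal_le_ofReal (cutoff_cross_le hp hn z.1 z.2)) _
  · have h := hE (2 ^ (p + 1)) (by positivity)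
    rw [kernelEnergy_ofReal] at h
    simp only [ENNReal.ofReal_mul (Nat.cast_nonneg s.card), mul_assoc]
    rw [lintegral_const_mul' _ _ ENNReal.ofReal_ne_top]
    exact ENNReal.mul_ne_top ENNReal.ofReal_ne_top (ne_top_of_le_ne_top (by simp) h)
  · refine ae_of_all _ fun z => ?_
    refine tendsto_const_nhds.congr' ?_
    obtain ⟨N, hN⟩ := pow_unbounded_of_one_lt (max |z.1| |z.2|) (one_lt_two : (1 : ℝ) < 2)
    filter_upwards [eventually_ge_atTop N] with n hn
    have hpow : (2 : ℝ) ^ N ≤ 2 ^ n := pow_le_pow_right₀ one_le_two hn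
    rw [cutoff_eq_one (by positivity) (((le_max_left _ _).trans hN.le).trans hpow),
      cutoff_eq_one (by positivity) (((le_max_right _ _).trans hN.le).trans hpow)]
    simp

/-- Each new scale is chosen so far out that its cross term is at most `1`. Expanding the square, it
adds at most `2 * 1 + 128 = 130`. -/
theorem exists_cutoffSum_energy_le {k : ℝ → ℝ → ℂ} (hk : Measurable (Function.uncurry k))
    (hE : ∀ M : ℝ, 0 < M → kernelEnergy μ k (fun x => (cutoff M x : ℂ)) ≤ 128) (N n : ℕ) :
    ∃ s : Finset ℕ, s.card = n ∧ (∀ m ∈ s, N ≤ m) ∧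
      kernelEnergy μ k (fun x => (cutoffSum s x : ℂ)) ≤ n * 130 := by
  induction n with
  | zero => exact ⟨∅, rfl, by simp, by simp [cutoffSum, kernelEnergy]⟩
  | succ n ih =>
    obtain ⟨s, hs, hsN, hsE⟩ := ih
    obtain ⟨p, hp⟩ := s.exists_le
    obtain ⟨q, hq1, hq2, hq3⟩ := (((tendsto_cross_energy hk hE s).eventually_le_const
      one_pos).and ((eventually_ge_atTop N).and (eventually_gt_atTop p))).exists
    have hqs : q ∉ s := fun h => absurd (hp q h) (not_le.2 hq3)
    refine ⟨insert q s, by rw [Finset.card_insert_of_notMem hqs, hs], ?_, ?_⟩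
    · intro m hm
      rcases Finset.mem_insert.1 hm with rfl | hm
      exacts [hq2, hsN m hm]
    have hmd : ∀ h : ℝ → ℝ, Measurable h → Measurable fun z : ℝ × ℝ => |h z.1 - h z.2| :=
      fun h hh => ((hh.comp measurable_fst).sub (hh.comp measurable_snd)).abs
    have hkm : Measurable fun z : ℝ × ℝ => ‖k z.1 z.2‖ₑ ^ 2 := hk.enorm.pow_const 2
    have hcut := hE (2 ^ q) (by positivity)
    rw [kernelEnergy_ofReal] at hsE hcut ⊢
    have hpt : ∀ z : ℝ × ℝ,
        ENNReal.ofReal (|cutoffSum (insert q s) z.1 - cutoffSum (insert q s) z.2| ^ 2)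
          * ‖k z.1 z.2‖ₑ ^ 2
        ≤ ENNReal.ofReal (|cutoffSum s z.1 - cutoffSum s z.2| ^ 2) * ‖k z.1 z.2‖ₑ ^ 2
          + (2 * (ENNReal.ofReal (|cutoffSum s z.1 - cutoffSum s z.2| *
            |cutoff (2 ^ q) z.1 - cutoff (2 ^ q) z.2|) * ‖k z.1 z.2‖ₑ ^ 2)
          + ENNReal.ofReal (|cutoff (2 ^ q) z.1 - cutoff (2 ^ q) z.2| ^ 2) * ‖k z.1 z.2‖ₑ ^ 2) := by
      intro z
      rw [← mul_assoc, ← add_mul, ← add_mul]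
      gcongr
      have h2 : (2 : ENNReal) = ENNReal.ofReal 2 := by simp
      rw [h2, ← ENNReal.ofReal_mul zero_le_two, ← ENNReal.ofReal_add (by positivity) (by positivity),
        ← ENNReal.ofReal_add (by positivity) (by positivity)]
      refine ENNReal.ofReal_le_ofReal ?_
      simp only [cutoffSum, Finset.sum_insert hqs]
      set u := ∑ m ∈ s, cutoff (2 ^ m) z.1
      set v := ∑ m ∈ s, cutoff (2 ^ m) z.2
      have h3 := abs_add_le (u - v) (cutoff (2 ^ q) z.1 - cutoff (2 ^ q) z.2)
      have h4 : cutoff (2 ^ q) z.1 + u - (cutoff (2 ^ q) z.2 + v)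
          = (u - v) + (cutoff (2 ^ q) z.1 - cutoff (2 ^ q) z.2) := by ring
      rw [h4]
      refine (pow_le_pow_left₀ (abs_nonneg _) h3 2).trans_eq ?_
      ring
    refine (lintegral_mono hpt).trans ?_
    have m1 : Measurable fun z : ℝ × ℝ => ENNReal.ofReal (|cutoffSum s z.1 - cutoffSum s z.2| ^ 2)
        * ‖k z.1 z.2‖ₑ ^ 2 := (((hmd _ (measurable_cutoffSum s)).pow_const 2).ennreal_ofReal).mul hkm
    have m2 : Measurable fun z : ℝ × ℝ => 2 * (ENNReal.ofReal (|cutoffSum s z.1 - cutoffSum s z.2| *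
        |cutoff (2 ^ q) z.1 - cutoff (2 ^ q) z.2|) * ‖k z.1 z.2‖ₑ ^ 2) := ((((hmd _ (measurable_cutoffSum s)).mul
      (hmd _ (measurable_cutoff (2 ^ q)))).ennreal_ofReal).mul hkm).const_mul 2
    rw [lintegral_add_left m1, lintegral_add_left m2, lintegral_const_mul' _ _ (by simp)]
    calc _ ≤ (n : ENNReal) * 130 + (2 * 1 + 128) := by gcongr
      _ = ((n + 1 : ℕ) : ENNReal) * 130 := by push_cast; rw [add_mul]; norm_num

theorem kernelEnergy_const_mul (k : ℝ → ℝ → ℂ) (h : ℝ → ℝ) {c : ℝ} (hc : 0 ≤ c) :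
    kernelEnergy μ k (fun x => ((c * h x : ℝ) : ℂ))
      = ENNReal.ofReal (c ^ 2) * kernelEnergy μ k (fun x => (h x : ℂ)) := by
  rw [kernelEnergy_ofReal, kernelEnergy_ofReal, ← lintegral_const_mul' _ _ ENNReal.ofReal_ne_top]
  refine lintegral_congr fun z => ?_
  rw [← mul_assoc, ← ENNReal.ofReal_mul (sq_nonneg c), ← mul_sub, abs_mul, mul_pow, abs_of_nonneg hc]

/-- The average of the cutoffs at the scales `2 ^ m`, `m ∈ s`. -/
noncomputable def cutoffAverage (s : Finset ℕ) (x : ℝ) : ℝ := (s.card : ℝ)⁻¹ * cutoffSum s x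

/-- The energy is quadratic, so normalization multiplies a bound linear in the number of cutoffs by
its inverse square. -/
theorem exists_cutoffAverage_energy_le {k : ℝ → ℝ → ℂ} (hk : Measurable (Function.uncurry k))
    (hE : ∀ M : ℝ, 0 < M → kernelEnergy μ k (fun x => (cutoff M x : ℂ)) ≤ 128) (N n : ℕ) :
    ∃ s : Finset ℕ, s.card = n + 1 ∧ (∀ m ∈ s, N ≤ m) ∧
      kernelEnergy μ k (fun x => (cutoffAverage s x : ℂ)) ≤ ENNReal.ofReal (130 / (n + 1)) := by
  obtain ⟨s, hs, hsN, hsE⟩ := exists_cutoffSum_energy_le hk hE N (n + 1)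
  refine ⟨s, hs, hsN, ?_⟩
  have h := kernelEnergy_const_mul (μ := μ) k (cutoffSum s)
    (c := (s.card : ℝ)⁻¹) (by positivity)
  unfold cutoffAverage
  rw [h]
  have h1 : ((n + 1 : ℕ) : ENNReal) * 130 = ENNReal.ofReal (((n + 1 : ℕ) : ℝ) * 130) := by
    rw [ENNReal.ofReal_mul (Nat.cast_nonneg _), ENNReal.ofReal_natCast]; simp
  rw [h1] at hsE
  calc _ ≤ ENNReal.ofReal (((s.card : ℝ)⁻¹) ^ 2) * ENNReal.ofReal (((n + 1 : ℕ) : ℝ) * 130) := by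
        gcongr
    _ = ENNReal.ofReal (130 / (n + 1)) := by
        rw [← ENNReal.ofReal_mul (by positivity), hs]
        congr 1
        push_cast
        field_simp

end Averages

/-! ### From small variance to rigidity. -/

section Rigidity

open Filter Topology Configuration

variable {μ : Measure ℝ} {T : Lp ℂ 2 μ →L[ℂ] Lp ℂ 2 μ} {P : Measure Configuration}

/-- The variance of a linear statistic is bounded by the energy of its test function. -/
theorem IsDeterminantal.variance_linStat_le [SFinite μ] [IsProbabilityMeasure P]
    (hP : IsDeterminantal μ T P) (hT : IsStarProjection T) {k : ℝ → ℝ → ℂ}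
    (hk : Measurable (Function.uncurry k)) (hTk : IsIntegralOperator μ k T) {D : Set ℝ}
    (hD : IsBounded D) (hDm : MeasurableSet D) {h : ℝ → ℝ} (hm : Measurable h)
    (h0 : ∀ x, 0 ≤ h x) (h1 : ∀ x, h x ≤ 1) (hh : ∀ x, x ∉ D → h x = 0) {q : ℝ} (hq : 0 ≤ q)
    (hE : kernelEnergy μ k (fun x => (h x : ℂ)) ≤ ENNReal.ofReal q) :
    ProbabilityTheory.variance (linStat h) P ≤ q := by
  obtain ⟨w, e, -⟩ := exists_hilbertBasis ℂ (Lp ℂ 2 μ)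
  obtain ⟨hs, hv⟩ := hP.variance_linStat hT hD hDm hm h0 h1 hh e _ rfl
  have hbd := isBddMeasurable_ofReal hm h0 h1
  have hκ : Measurable (Function.uncurry fun x y => ((h x : ℂ) - (h y : ℂ)) * k x y) :=
    ((hbd.measurable.comp measurable_fst).sub (hbd.measurable.comp measurable_snd)).mul hk
  have hle := hs.tsum_le_of_sum_le fun F => (ENNReal.ofReal_le_ofReal_iff hq).1
    (((hTk.commutator hbd).sum_norm_sq_le hκ e.orthonormal F).trans hE)
  rw [hv]
  -- The factor `1 / 2` in the variance formula is simply discarded.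
  linarith

/-- Rigidity follows from the existence of test functions, equal to one on a given bounded set,
whose linear statistics have arbitrarily small variance. -/
theorem isRigid_of_forall_variance_le [IsProbabilityMeasure P]
    (hL : ∀ (D : Set ℝ) (h : ℝ → ℝ), IsBounded D → MeasurableSet D → Measurable h →
      (∀ x, 0 ≤ h x) → (∀ x, h x ≤ 1) → (∀ x, x ∉ D → h x = 0) → MemLp (linStat h) 2 P)
    (hV : ∀ B : Set ℝ, IsBounded B → ∃ q : ℕ → ℝ, Tendsto q atTop (𝓝 0) ∧ ∀ n, ∃ (D : Set ℝ) (h : ℝ → ℝ),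
      IsBounded D ∧ MeasurableSet D ∧ Measurable h ∧ (∀ x, 0 ≤ h x) ∧ (∀ x, h x ≤ 1) ∧
      (∀ x, x ∉ D → h x = 0) ∧ (∀ x ∈ B, h x = 1) ∧
      ProbabilityTheory.variance (linStat h) P ≤ q n) : IsRigid P := by
  intro B hB hBm
  obtain ⟨q, hq, hV⟩ := hV B hB
  choose D h hD hDm hm h0 h1 hh hhB hvar using hV
  have hmeas : TendstoInMeasure P (fun n X => linStat (h n) X - ∫ Y, linStat (h n) Y ∂P) atTop
      (fun _ => 0) := by
    rw [tendstoInMeasure_iff_norm]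
    intro c hc
    have h2 : Tendsto (fun n => ENNReal.ofReal (q n / c ^ 2)) atTop (𝓝 0) := by
      have := ENNReal.tendsto_ofReal (hq.div_const (c ^ 2))
      simpa using this
    refine tendsto_of_tendsto_of_tendsto_of_le_of_le tendsto_const_nhds h2 (fun _ => zero_le)
      fun n => ?_
    have := ProbabilityTheory.meas_ge_le_variance_div_sq
      (hL _ _ (hD n) (hDm n) (hm n) (h0 n) (h1 n) (hh n)) hc
    simp only [sub_zero, Real.norm_eq_abs]
    refine this.trans (ENNReal.ofReal_le_ofReal ?_)
    gcongr
    exact hvar n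
  -- Chebyshev's inequality gives convergence in measure only; a subsequence converges almost
  -- surely.
  obtain ⟨ns, -, hns⟩ := hmeas.exists_seq_tendsto_ae
  set u : ℕ → Configuration → ℝ := fun j X =>
    (∫ Y, linStat (h (ns j)) Y ∂P) - linStat (Bᶜ.indicator (h (ns j))) X with hu
  -- Since `h n = 1` on `B`, the particles in `B` contribute exactly their number.
  have hsplit : ∀ n X, linStat (h n) X = count B X + linStat (Bᶜ.indicator (h n)) X := by
    intro n X
    rw [← linStat_indicator_one X hB, ← linStat_add X (hB.union (hD n))]
    · congr 1
      funext x
      by_cases hx : x ∈ B <;> simp [hx, hhB n]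
    · exact fun x hx => Set.indicator_of_notMem (fun h' => hx (Or.inl h')) _
    · intro x hx
      by_cases hxB : x ∈ B
      · simp [hxB]
      · simp [hxB, hh n x fun h' => hx (Or.inr h')]
  have hlim : ∀ᵐ X ∂P, Tendsto (fun j => u j X) atTop (𝓝 (count B X : ℝ)) := by
    filter_upwards [hns] with X hX
    have := hX.const_sub (count B X : ℝ)
    rw [sub_zero] at this
    refine this.congr fun j => ?_
    rw [hsplit]
    simp only [hu]
    ring
  have hum : ∀ j, Measurable[sigmaAlgebraOn Bᶜ] (u j) := by
    intro j
    have := measurable_linStat_on (C := Bᶜ) ((hD (ns j)).subset Set.inter_subset_left)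
      ((hDm (ns j)).inter hBm.compl) Set.inter_subset_right ((hm (ns j)).indicator hBm.compl)
      (fun x => Set.indicator_nonneg (fun x _ => h0 (ns j) x) x) (fun x hx => by
        by_cases hxB : x ∈ B
        · simp [hxB]
        · simp [hxB, hh (ns j) x fun h' => hx ⟨h', hxB⟩])
    exact (measurable_id.const_sub (∫ Y, linStat (h (ns j)) Y ∂P)).comp this
  -- The upper limit is defined for every configuration and is exterior measurable, while it equals
  -- the count in `B` almost surely; this gives measurability for the completion.
  have hZm : Measurable[sigmaAlgebraOn Bᶜ] fun X => limsup (fun j => u j X) atTop :=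
    @Measurable.limsup _ _ _ _ _ (sigmaAlgebraOn Bᶜ) _ _ _ _ hum
  intro t _
  refine ⟨(fun X => limsup (fun j => u j X) atTop) ⁻¹' ((Nat.cast : ℕ → ℝ) '' t),
    hZm (t.to_countable.image _).measurableSet, ?_⟩
  filter_upwards [hlim] with X hX
  refine propext ?_
  change count B X ∈ t ↔ limsup (fun j => u j X) atTop ∈ (Nat.cast : ℕ → ℝ) '' t
  rw [hX.limsup_eq]
  simp

/-- A determinantal process governed by a projection with an integrable kernel is rigid. No growth
condition on `a` and `b` is needed: the commutators of the projection with the functions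
`iM / (x + iM)` have rank at most two, so the linear statistics of cutoffs at all scales have
uniformly bounded variance, cutoffs at distant scales are almost uncorrelated, and averages of such
cutoffs have arbitrarily small variance. -/
theorem IsDeterminantal.isRigid [SigmaFinite μ] [IsLocallyFiniteMeasure μ] [NullSingletonClass μ]
    [IsProbabilityMeasure P] (hP : IsDeterminantal μ T P) (hT : IsStarProjection T)
    {a b : ℝ → ℂ} (ha : Measurable a) (hb : Measurable b)
    (hTk : IsIntegralOperator μ (integrableKernel a b) T) : IsRigid P := by
  refine isRigid_of_forall_variance_le
    (fun D h hD hDm hm h0 h1 hh => hP.memLp_linStat hD hDm hm h0 h1 hh) fun B hB => ?_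
  have hk := measurable_integrableKernel ha hb
  have hE : ∀ M : ℝ, 0 < M →
      kernelEnergy μ (integrableKernel a b) (fun x => (cutoff M x : ℂ)) ≤ 128 := fun M hM =>
    kernelEnergy_cutoff_le (kernelEnergy_moebiusCutoff_le ha hb hTk (hT.norm_le T) hM)
  -- Only scales `2 ^ m` with `m ≥ N` and `2 ^ N > r` are used, so every cutoff in the average
  -- equals `1` on `B`.
  obtain ⟨r, hr⟩ := hB.subset_closedBall 0
  obtain ⟨N, hN⟩ := pow_unbounded_of_one_lt r (one_lt_two : (1 : ℝ) < 2)
  refine ⟨fun n => 130 / (n + 1), ?_, fun n => ?_⟩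
  · simpa [div_eq_mul_inv] using (tendsto_one_div_add_atTop_nhds_zero_nat (𝕜 := ℝ)).const_mul 130
  obtain ⟨s, hs, hsN, hsE⟩ := exists_cutoffAverage_energy_le hk hE N n
  obtain ⟨p, hp⟩ := s.exists_le
  have hpos : (0 : ℝ) < s.card := by rw [hs]; positivity
  have hDb : IsBounded (Metric.closedBall (0 : ℝ) (2 ^ (p + 1))) := Metric.isBounded_closedBall
  have hDm : MeasurableSet (Metric.closedBall (0 : ℝ) (2 ^ (p + 1))) :=
    Metric.isClosed_closedBall.measurableSet
  have hm : Measurable (cutoffAverage s) := (measurable_cutoffSum s).const_mul _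
  have h0 : ∀ x, 0 ≤ cutoffAverage s x := fun x =>
    mul_nonneg (by positivity) (cutoffSum_nonneg s x)
  have h1 : ∀ x, cutoffAverage s x ≤ 1 := fun x => by
    rw [cutoffAverage, inv_mul_le_one₀ hpos]
    exact cutoffSum_le s x
  have hh : ∀ x, x ∉ Metric.closedBall (0 : ℝ) (2 ^ (p + 1)) → cutoffAverage s x = 0 := by
    intro x hx
    rw [mem_closedBall_zero_iff, not_le, Real.norm_eq_abs] at hx
    rw [cutoffAverage, cutoffSum_eq_zero hp hx.le, mul_zero]
  refine ⟨Metric.closedBall 0 (2 ^ (p + 1)), cutoffAverage s, hDb, hDm, hm, h0, h1, hh, ?_,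
    hP.variance_linStat_le hT hk hTk hDb hDm hm h0 h1 hh (by positivity) hsE⟩
  intro x hx
  have hxr := hr hx
  rw [mem_closedBall_zero_iff, Real.norm_eq_abs] at hxr
  rw [cutoffAverage, cutoffSum_eq_card hsN (hxr.trans hN.le), inv_mul_cancel₀ hpos.ne']

/-- Off `U` the given functions are arbitrary; extension by zero makes them Borel on the line
without affecting the operator. -/
theorem measurable_indicator_of_contDiffOn {U : Set ℝ} (hU : IsOpen U) {f : ℝ → ℂ}
    (hf : ContDiffOn ℝ ∞ f U) : Measurable (U.indicator f) := by
  classical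
  rw [← Set.piecewise_eq_indicator]
  exact hf.continuousOn.measurable_piecewise continuousOn_const hU.measurableSet

/-- Only the off-diagonal values of the kernel matter for the integral operator. -/
theorem HasIntegrableForm.isIntegralOperator {U : Set ℝ} (hU : IsOpen U) {K : ℝ → ℝ → ℂ}
    {A B : ℝ → ℂ} (hAB : HasIntegrableForm U K A B)
    {T : Lp ℂ 2 (volume.restrict U) →L[ℂ] Lp ℂ 2 (volume.restrict U)}
    (hT : IsIntegralOperator (volume.restrict U) K T) :
    IsIntegralOperator (volume.restrict U)
      (integrableKernel (U.indicator A) (U.indicator B)) T := by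
  intro f
  have hmem : ∀ᵐ x ∂(volume.restrict U), x ∈ U := ae_restrict_mem hU.measurableSet
  filter_upwards [hT f, hmem] with x hx hxU
  have hne : ∀ᵐ y ∂(volume.restrict U), y ≠ x := by
    rw [ae_iff]; simp
  have hcongr : (fun y => K x y * f y) =ᵐ[volume.restrict U]
      fun y => integrableKernel (U.indicator A) (U.indicator B) x y * f y := by
    filter_upwards [hmem, hne] with y hyU hyx
    rw [hAB.off_diag x hxU y hyU hyx.symm, integrableKernel]
    simp only [Set.indicator_of_mem hxU, Set.indicator_of_mem hyU]
  exact ⟨hx.1.congr hcongr, hx.2.trans (integral_congr_ae hcongr)⟩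

end Rigidity

theorem mainTheorem6 (U : Set ℝ) (hU : IsOpen U)
    (K : ℝ → ℝ → ℂ) (T : Lp ℂ 2 (volume.restrict U) →L[ℂ] Lp ℂ 2 (volume.restrict U))
    (hproj : IsStarProjection T)
    (hker : IsIntegralOperator (volume.restrict U) K T)
    (hloc : IsLocallyTraceClass (volume.restrict U) T)
    (P : Measure Configuration) [IsProbabilityMeasure P]
    (hP : IsDeterminantal (volume.restrict U) T P)
    (A B : ℝ → ℂ) (hAB : HasIntegrableForm U K A B)
    (R C ε : ℝ) (hR : 0 < R) (hC : 0 < C) (hε : 0 < ε)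
    (hA_small : ∀ x ∈ U, x ≠ 0 → |x| < R → ‖A x‖ ≤ C * |x| ^ (-(1 / 2 : ℝ) + ε))
    (hB_small : ∀ x ∈ U, x ≠ 0 → |x| < R → ‖B x‖ ≤ C * |x| ^ (-(1 / 2 : ℝ) + ε))
    (hA_large : ∀ x ∈ U, R < |x| → ‖A x‖ ≤ C * |x| ^ ((1 / 2 : ℝ) - ε))
    (hB_large : ∀ x ∈ U, R < |x| → ‖B x‖ ≤ C * |x| ^ ((1 / 2 : ℝ) - ε)) :
    IsRigid P := by
  exact hP.isRigid hproj (measurable_indicator_of_contDiffOn hU hAB.smooth_left)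
    (measurable_indicator_of_contDiffOn hU hAB.smooth_right) (hAB.isIntegralOperator hU hker)
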